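/- Let $d\ge 1$ be an integer and $\mathcal A=\{0,1,\dots,2d\}$. Let $\mathbf u=\mathbf u_{2d+1}$ be the unique fixed point $\varphi(\mathbf u)=\mathbf u\in\mathcal A^{\mathbb N}$ of the morphism $\varphi$ on $\mathcal A^*$ given by $\varphi(i)=0(i+1)$ for $0\le i\le 2d-1$ and $\varphi(2d)=0(2d)(2d)$. Put $h_i=1$ for $0\le i<d$ and $h_i=2^{i-d}$ for $d\le i\le 2d$. Let $\pi:\mathcal A^*\to\mathcal B^*$ be a weighted morphism, that is, a morphism such that for every $i\in\mathcal A$: (a) $\pi(i)$ is a palindrome of length $h_i$; (b) the number of distinct letters of $\pi(i)$ is the maximum among palindromes over $\mathcal B$ of length $h_i$; (c) no letter of $\pi(i)$ occurs in $\pi(j)$ for $j\ne i$. Write $\pi(\mathbf u)=\pi(u_0)\pi(u_1)\pi(u_2)\cdots$. A factor of a sequence is left (right) special if it can be extended to the left (right) by at least two distinct letters to a factor of the sequence, and bispecial if it is both. A return word to a factor $v$ of a sequence $x_0x_1x_2\cdots$ is a word $x_jx_{j+1}\cdots x_{\ell-1}$, where $j<\ell$ are two consecutive occurrences of $v$. A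 word $v$ is rich if it has $|v|+1$ distinct palindromic factors (including the empty word), and a sequence is rich if each of its factors is rich. Then: 1. A factor $p$ of $\mathbf u$ is a palindrome if and only if $\pi(p)$ is a palindrome. 2. The sequence $\pi(\mathbf u)$ is rich. 3. Suppose $d\ge 2$. If $w'$ is a bispecial factor of $\pi(\mathbf u)$ of length $>1$, then there is a bispecial factor $w$ of $\mathbf u$ with $w'=\pi(w)$, and for every return word $r'$ to $w'$ in $\pi(\mathbf u)$ there is a return word $r$ to $w$ in $\mathbf u$ with $r'=\pi(r)$. -/

import Mathlib

/-! Words over an alphabet `A` are lists `List A`; sequences are functions `ℕ → A`. -/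

namespace RichWords

/-- The word `u_j u_{j+1} ⋯ u_{j+n-1}`. -/
def window {A : Type*} (u : ℕ → A) (j n : ℕ) : List A :=
  (List.range n).map fun i => u (j + i)

/-- `j` is an occurrence of the word `w` in the sequence `u`. -/
def IsOccurrence {A : Type*} (u : ℕ → A) (w : List A) (j : ℕ) : Prop :=
  window u j w.length = w

/-- `w` is a factor of the sequence `u`. -/
def IsFactor {A : Type*} (u : ℕ → A) (w : List A) : Prop :=
  ∃ j, IsOccurrence u w j

def IsLeftSpecial {A : Type*} (u : ℕ → A) (w : List A) : Prop :=
  IsFactor u w ∧ ∃ a b : A, a ≠ b ∧ IsFactor u (a :: w) ∧ IsFactor u (b :: w)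

def IsRightSpecial {A : Type*} (u : ℕ → A) (w : List A) : Prop :=
  IsFactor u w ∧ ∃ a b : A, a ≠ b ∧ IsFactor u (w ++ [a]) ∧ IsFactor u (w ++ [b])

def IsBispecial {A : Type*} (u : ℕ → A) (w : List A) : Prop :=
  IsLeftSpecial u w ∧ IsRightSpecial u w

/-- `r` is a return word to `w` in `u`: it is `u_j ⋯ u_{l-1}` for two consecutive
occurrences `j < l` of `w`. -/
def IsReturnWord {A : Type*} (u : ℕ → A) (w r : List A) : Prop :=
  ∃ j l : ℕ, j < l ∧ IsOccurrence u w j ∧ IsOccurrence u w l ∧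
    (∀ k, j < k → k < l → ¬ IsOccurrence u w k) ∧ r = window u j (l - j)

/-- A word is rich if it has `|w| + 1` distinct palindromic factors (the empty word included). -/
def IsRichWord {A : Type*} (w : List A) : Prop :=
  {p : List A | p <:+: w ∧ p.Palindrome}.ncard = w.length + 1

/-- A sequence is rich if each of its factors is rich. -/
def IsRichSeq {A : Type*} (u : ℕ → A) : Prop :=
  ∀ w, IsFactor u w → IsRichWord w

/-- A morphism `A* → B*` is given by the images `ψ a` of the letters;
this is the image of a word. -/
def wordImage {A B : Type*} (ψ : A → List B) (w : List A) : List B :=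
  w.flatMap ψ

theorem le_length_wordImage {A B : Type*} {ψ : A → List B} (hψ : ∀ a, ψ a ≠ [])
    (w : List A) : w.length ≤ (wordImage ψ w).length := by
  induction w with
  | nil => simp
  | cons a w ih =>
    have := List.length_pos_iff.2 (hψ a)
    simp only [wordImage, List.flatMap_cons, List.length_append, List.length_cons] at ih ⊢
    omega

/-- The image `ψ(u_0) ψ(u_1) ψ(u_2) ⋯` of a sequence under a non-erasing morphism: its `n`-th
letter is the `n`-th letter of `ψ(u_0 ⋯ u_n)`, a word of length at least `n + 1`. -/
def seqImage {A B : Type*} (ψ : A → List B) (hψ : ∀ a, ψ a ≠ []) (u : ℕ → A) : ℕ → B :=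
  fun n => (wordImage ψ (window u 0 (n + 1)))[n]'(by
    have := le_length_wordImage hψ (window u 0 (n + 1))
    simp only [window, List.length_map, List.length_range] at this ⊢
    omega)

/-- The morphism `0 ↦ 01, 1 ↦ 02, …, n-2 ↦ 0(n-1), n-1 ↦ 0(n-1)(n-1)` on `{0, …, n-1}`. -/
def phi (n : ℕ) [NeZero n] (i : Fin n) : List (Fin n) :=
  if h : i.val + 1 < n then [0, ⟨i.val + 1, h⟩] else [0, i, i]

theorem phi_ne_nil (n : ℕ) [NeZero n] (i : Fin n) : phi n i ≠ [] := by
  unfold phi; split <;> simp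

theorem two_mul_length_le (n : ℕ) [NeZero n] (w : List (Fin n)) :
    2 * w.length ≤ (wordImage (phi n) w).length := by
  induction w with
  | nil => simp
  | cons a w ih =>
    have : 2 ≤ (phi n a).length := by unfold phi; split <;> simp
    simp only [wordImage, List.flatMap_cons, List.length_append, List.length_cons] at ih ⊢
    omega

theorem lt_length_iterate (n : ℕ) [NeZero n] (k : ℕ) :
    k < ((wordImage (phi n))^[k] [0]).length := by
  induction k with
  | zero => simp
  | succ k ih =>
    rw [Function.iterate_succ_apply']
    have := two_mul_length_le n ((wordImage (phi n))^[k] [0])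
    omega

/-- The fixed point of `phi n`, i.e. the limit of the words `phi^k(0)`: its `k`-th letter is the
`k`-th letter of `phi^k(0)`, a word of length at least `k + 1`. -/
def uSeq (n : ℕ) [NeZero n] : ℕ → Fin n :=
  fun k => ((wordImage (phi n))^[k] [0])[k]'(lt_length_iterate n k)

/-- The weights `(1, …, 1, 2^0, 2^1, …, 2^d)`, with `d` ones in front. -/
def weight (d i : ℕ) : ℕ := if i < d then 1 else 2 ^ (i - d)

/-- Weighted morphisms `{0, …, 2d}* → B*`. -/
structure IsWeightedMorphism {B : Type*} (d : ℕ) (π : Fin (2 * d + 1) → List B) : Prop where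
  palindrome : ∀ i, (π i).Palindrome
  length_eq : ∀ i, (π i).length = weight d i
  /-- No palindrome of the same length contains more distinct letters. -/
  maximal : ∀ i : Fin (2 * d + 1), ∀ q : List B, q.Palindrome → q.length = weight d i →
    {b | b ∈ q}.ncard ≤ {b | b ∈ π i}.ncard
  disjoint : ∀ i j, i ≠ j → ∀ b ∈ π i, b ∉ π j

theorem IsWeightedMorphism.ne_nil {B : Type*} {d : ℕ} {π : Fin (2 * d + 1) → List B}
    (h : IsWeightedMorphism d π) (i : Fin (2 * d + 1)) : π i ≠ [] := by
  rw [← List.length_pos_iff, h.length_eq]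
  unfold weight; split <;> positivity

/-! `uSeq n` is a fixed point of `phi n`, and the only one. -/

theorem window_add {A : Type*} (u : ℕ → A) (m k : ℕ) :
    window u 0 (m + k) = window u 0 m ++ window u m k := by
  simp [window, List.range_add, Function.comp_def]

theorem window_prefix {A : Type*} (u : ℕ → A) {m k : ℕ} (h : m ≤ k) :
    window u 0 m <+: window u 0 k := by
  obtain ⟨t, rfl⟩ := Nat.exists_eq_add_of_le h
  exact ⟨_, (window_add u m t).symm⟩

theorem wordImage_prefix {A B : Type*} (ψ : A → List B) {v w : List A} (h : v <+: w) :
    wordImage ψ v <+: wordImage ψ w := by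
  obtain ⟨t, rfl⟩ := h
  exact ⟨wordImage ψ t, by simp [wordImage]⟩

theorem prefix_getElem {A : Type*} {v w : List A} (h : v <+: w) (k : ℕ) (hk : k < v.length) :
    v[k] = w[k]'(hk.trans_le h.length_le) := by
  obtain ⟨t, rfl⟩ := h
  simp [List.getElem_append_left hk]

theorem eq_window {A : Type*} (u : ℕ → A) (w : List A)
    (h : ∀ k (hk : k < w.length), w[k] = u k) : w = window u 0 w.length := by
  apply List.ext_getElem
  · simp [window]
  · intro k h1 h2
    simp [window, h k h1]

/-- `ψ(u_0 ⋯ u_{m-1})` is a prefix of `ψ(u)`. -/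
theorem wordImage_window {A B : Type*} (ψ : A → List B) (hψ : ∀ a, ψ a ≠ []) (u : ℕ → A)
    (m : ℕ) : wordImage ψ (window u 0 m) =
      window (seqImage ψ hψ u) 0 (wordImage ψ (window u 0 m)).length := by
  apply eq_window
  intro k hk
  have hl := le_length_wordImage hψ (window u 0 (k + 1))
  have hl' : (window u 0 (k + 1)).length = k + 1 := by simp [window]
  unfold seqImage
  rcases le_total m (k + 1) with h | h
  · exact prefix_getElem (wordImage_prefix ψ (window_prefix u h)) k hk
  · exact (prefix_getElem (wordImage_prefix ψ (window_prefix u h)) k (by omega)).symm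

theorem iterate_prefix (n : ℕ) [NeZero n] (hn : 2 ≤ n) {k l : ℕ} (h : k ≤ l) :
    (wordImage (phi n))^[k] [0] <+: (wordImage (phi n))^[l] [0] := by
  induction l, h using Nat.le_induction with
  | base => exact List.prefix_rfl
  | succ l hl ih =>
    refine ih.trans ?_
    clear ih hl
    induction l with
    | zero => exact ⟨[⟨1, by omega⟩], by simp [wordImage, phi, show 1 < n by omega]⟩
    | succ l ih =>
      rw [Function.iterate_succ_apply' _ l, Function.iterate_succ_apply' _ (l + 1)]
      exact wordImage_prefix _ ih

theorem seqImage_eq_self_iff (n : ℕ) [NeZero n] (hn : 2 ≤ n) (u : ℕ → Fin n) :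
    seqImage (phi n) (phi_ne_nil n) u = u ↔ u = uSeq n := by
  have key : ∀ k, (wordImage (phi n))^[k] [0] =
      window (uSeq n) 0 ((wordImage (phi n))^[k] [0]).length := by
    intro k
    apply eq_window
    intro m hm
    unfold uSeq
    rcases le_total k m with h | h
    · exact prefix_getElem (iterate_prefix n hn h) m hm
    · exact (prefix_getElem (iterate_prefix n hn h) m (lt_length_iterate n m)).symm
  have hwin : ∀ {v w : ℕ → Fin n} {m : ℕ}, window v 0 m = window w 0 m →
      ∀ k < m, v k = w k := by
    intro v w m h k hk
    have := congrArg (fun l => l[k]?) h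
    simpa [window, hk] using this
  constructor
  · intro hu
    have h0 : u 0 = 0 := by
      rw [← hu]
      have h1 : window u 0 1 = [u 0] := by simp [window]
      unfold seqImage
      simp only [Nat.zero_add, h1, wordImage, List.flatMap_cons, List.flatMap_nil,
        List.append_nil, phi]
      split <;> simp
    have hk : ∀ k, (wordImage (phi n))^[k] [0] =
        window u 0 ((wordImage (phi n))^[k] [0]).length := by
      intro k
      induction k with
      | zero => simp [window, h0]
      | succ k ih =>
        rw [Function.iterate_succ_apply', ih]
        have := wordImage_window (phi n) (phi_ne_nil n) u
          ((wordImage (phi n))^[k] [0]).length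
        rwa [hu] at this
    funext k
    exact hwin ((hk k).symm.trans (key k)) k (lt_length_iterate n k)
  · rintro rfl
    funext k
    have h1 := wordImage_window (phi n) (phi_ne_nil n) (uSeq n)
      ((wordImage (phi n))^[k] [0]).length
    rw [← key k, ← Function.iterate_succ_apply' (wordImage (phi n)) k] at h1
    exact hwin (h1.symm.trans (key (k + 1))) k
      ((Nat.lt_succ_self k).trans (lt_length_iterate n (k + 1)))

end RichWords

open RichWords

/-!
A sequence is rich as soon as any two consecutive occurrences of a palindrome span a palindrome:
then the longest palindromic suffix of a word `w b` does not occur in `w`, so every letter adds a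
palindrome.

Both `phi` and `π ∘ phi` send each letter to a marker (`0`, respectively the letter `π(0)`)
followed by a palindrome free of the marker. A palindrome containing the marker therefore
desubstitutes to a shorter palindrome of the fixed point. Its overhang on both sides restricts the
letters around that preimage to a set `T`, so the induction is about occurrences between letters
of `T`; the sets that arise have at most one element or are final segments of the alphabet. A
palindrome avoiding the marker lies inside a block, which is one or two copies of a palindrome
with distinct letters in its first half; there consecutive occurrences are compared inside a
periodic sequence.

For the bispecial factors: a letter of `π(u)` determines its offset in its block up to reflection,
and two consecutive letters determine it completely when the squares `ii` in `u` have long blocks.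
Hence all occurrences of a longer word are cut by the blocks in the same way, and a bispecial word
must start and end at a block boundary.
-/

namespace RichWords

variable {A B C : Type*}

/-! ### Windows and occurrences -/

@[simp] theorem length_window (u : ℕ → A) (j n : ℕ) : (window u j n).length = n := by
  simp [window]

theorem window_append (u : ℕ → A) (j m k : ℕ) :
    window u j (m + k) = window u j m ++ window u (j + m) k := by
  simp [window, List.range_add, Function.comp_def, Nat.add_assoc]

@[simp] theorem window_one (u : ℕ → A) (j : ℕ) : window u j 1 = [u j] := by
  simp [window]

theorem window_succ (u : ℕ → A) (j n : ℕ) :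
    window u j (n + 1) = u j :: window u (j + 1) n := by
  rw [Nat.add_comm, window_append, window_one, List.singleton_append]

@[simp] theorem getElem_window (u : ℕ → A) (j n k : ℕ) (hk : k < (window u j n).length) :
    (window u j n)[k] = u (j + k) := by
  simp [window]

@[simp] theorem isOccurrence_nil (u : ℕ → A) (j : ℕ) : IsOccurrence u [] j := rfl

theorem isOccurrence_cons {u : ℕ → A} {b : A} {w : List A} {j : ℕ} :
    IsOccurrence u (b :: w) j ↔ u j = b ∧ IsOccurrence u w (j + 1) := by
  simp [IsOccurrence, window_succ]

theorem isOccurrence_singleton {u : ℕ → A} {b : A} {j : ℕ} :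
    IsOccurrence u [b] j ↔ u j = b := by
  simp [isOccurrence_cons]

theorem isOccurrence_append {u : ℕ → A} {w w' : List A} {j : ℕ} :
    IsOccurrence u (w ++ w') j ↔ IsOccurrence u w j ∧ IsOccurrence u w' (j + w.length) := by
  rw [IsOccurrence, List.length_append, window_append]
  exact ⟨fun h => List.append_inj h (length_window _ _ _),
    fun h => congrArg₂ (· ++ ·) h.1 h.2⟩

theorem isOccurrence_window (u : ℕ → A) (j n : ℕ) : IsOccurrence u (window u j n) j := by
  simp [IsOccurrence]

theorem isOccurrence_iff_getElem {u : ℕ → A} {w : List A} {j : ℕ} :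
    IsOccurrence u w j ↔ ∀ t (ht : t < w.length), u (j + t) = w[t] := by
  simp [IsOccurrence, List.ext_getElem_iff]

namespace IsOccurrence

variable {u : ℕ → A} {w w' : List A} {j j' : ℕ}

theorem eq_of_length (h : IsOccurrence u w j) (h' : IsOccurrence u w' j)
    (hl : w.length = w'.length) : w = w' := by
  rw [← h, ← h', hl]

theorem of_prefix (h : IsOccurrence u w j) (h' : w' <+: w) : IsOccurrence u w' j := by
  obtain ⟨t, rfl⟩ := h'
  exact (isOccurrence_append.1 h).1

theorem of_suffix (h : IsOccurrence u w j) (h' : w' <:+ w)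
    (hj : j' + w'.length = j + w.length) : IsOccurrence u w' j' := by
  obtain ⟨t, rfl⟩ := h'
  obtain rfl : j' = j + t.length := by simp at hj; omega
  exact (isOccurrence_append.1 h).2

theorem prefix_of_length_le (h : IsOccurrence u w j) (h' : IsOccurrence u w' j)
    (hl : w.length ≤ w'.length) : w <+: w' := by
  rw [h.eq_of_length (h'.of_prefix (List.take_prefix w.length w')) (by simpa using hl)]
  exact List.take_prefix _ _

theorem suffix_of_length_le (h : IsOccurrence u w j) (h' : IsOccurrence u w' j')
    (hj : j + w.length = j' + w'.length) (hl : w.length ≤ w'.length) : w <:+ w' := by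
  have hdrop := h'.of_suffix (List.drop_suffix (w'.length - w.length) w') (j' := j)
    (by simp; omega)
  rw [h.eq_of_length hdrop (by simp; omega)]
  exact List.drop_suffix _ _

theorem palindrome_window {n : ℕ} (h : IsOccurrence u w j) (hw : w.Palindrome)
    (hn : w.length = n) : (window u j n).Palindrome := by
  subst hn
  rwa [h]

end IsOccurrence

/-! ### Images of sequences -/

@[simp] theorem wordImage_nil (ψ : A → List B) : wordImage ψ [] = [] := rfl

@[simp] theorem wordImage_cons (ψ : A → List B) (a : A) (w : List A) :
    wordImage ψ (a :: w) = ψ a ++ wordImage ψ w := by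
  simp [wordImage]

@[simp] theorem wordImage_append (ψ : A → List B) (v w : List A) :
    wordImage ψ (v ++ w) = wordImage ψ v ++ wordImage ψ w := by
  simp [wordImage]

theorem wordImage_wordImage (π : B → List C) (ψ : A → List B) (w : List A) :
    wordImage π (wordImage ψ w) = wordImage (fun a => wordImage π (ψ a)) w :=
  List.flatMap_assoc

theorem wordImage_injective {ψ : A → List B} (hne : ∀ a, ψ a ≠ [])
    (hψ : ∀ a b, ψ a <+: ψ b → a = b) : Function.Injective (wordImage ψ) := by
  intro x
  induction x with
  | nil =>
    rintro (_ | ⟨b, y⟩) h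
    · rfl
    · simp [hne] at h
  | cons a x ih =>
    rintro (_ | ⟨b, y⟩) h
    · simp [hne] at h
    · rw [wordImage_cons, wordImage_cons] at h
      obtain rfl : a = b := by
        rcases List.prefix_or_prefix_of_prefix (List.prefix_append _ (wordImage ψ x))
          (h.symm ▸ List.prefix_append _ (wordImage ψ y)) with hab | hba
        exacts [hψ a b hab, (hψ b a hba).symm]
      rw [ih (List.append_cancel_left h)]

/-- `v` is the sequence `ψ(u_0) ψ(u_1) ψ(u_2) ⋯`, provided this is infinite. -/
def IsImage (ψ : A → List B) (u : ℕ → A) (v : ℕ → B) : Prop :=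
  ∀ m, IsOccurrence v (wordImage ψ (window u 0 m)) 0

theorem isImage_seqImage (ψ : A → List B) (hψ : ∀ a, ψ a ≠ []) (u : ℕ → A) :
    IsImage ψ u (seqImage ψ hψ u) :=
  fun m => (wordImage_window ψ hψ u m).symm

/-- The position in `ψ(u)` where the block `ψ(u_m)` starts. -/
def blockStart (ψ : A → List B) (u : ℕ → A) (m : ℕ) : ℕ :=
  (wordImage ψ (window u 0 m)).length

@[simp] theorem blockStart_zero (ψ : A → List B) (u : ℕ → A) : blockStart ψ u 0 = 0 := rfl

theorem blockStart_add (ψ : A → List B) (u : ℕ → A) (m k : ℕ) :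
    blockStart ψ u (m + k) = blockStart ψ u m + (wordImage ψ (window u m k)).length := by
  simp [blockStart, window_append]

theorem blockStart_add_length (ψ : A → List B) {u : ℕ → A} {w : List A} {m : ℕ}
    (h : IsOccurrence u w m) :
    blockStart ψ u (m + w.length) = blockStart ψ u m + (wordImage ψ w).length := by
  rw [blockStart_add, h]

theorem blockStart_succ (ψ : A → List B) (u : ℕ → A) (m : ℕ) :
    blockStart ψ u (m + 1) = blockStart ψ u m + (ψ (u m)).length := by
  simp [blockStart_add]

theorem blockStart_strictMono {ψ : A → List B} (hψ : ∀ a, ψ a ≠ []) (u : ℕ → A) :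
    StrictMono (blockStart ψ u) := by
  refine strictMono_nat_of_lt_succ fun m => ?_
  rw [blockStart_succ]
  exact Nat.lt_add_of_pos_right (List.length_pos_iff.2 (hψ (u m)))

theorem exists_block {ψ : A → List B} (hψ : ∀ a, ψ a ≠ []) (u : ℕ → A) (n : ℕ) :
    ∃ m o, n = blockStart ψ u m + o ∧ o < (ψ (u m)).length := by
  induction n with
  | zero => exact ⟨0, 0, by simp, List.length_pos_iff.2 (hψ _)⟩
  | succ n ih =>
    obtain ⟨m, o, h, ho⟩ := ih
    by_cases h1 : o + 1 < (ψ (u m)).length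
    · exact ⟨m, o + 1, by omega, h1⟩
    · exact ⟨m + 1, 0, by rw [blockStart_succ]; omega, List.length_pos_iff.2 (hψ _)⟩

theorem block_unique {ψ : A → List B} {u : ℕ → A} {m m' o o' : ℕ} (hψ : ∀ a, ψ a ≠ [])
    (h : blockStart ψ u m + o = blockStart ψ u m' + o') (ho : o < (ψ (u m)).length)
    (ho' : o' < (ψ (u m')).length) : m = m' ∧ o = o' := by
  have hmono := (blockStart_strictMono hψ u).monotone
  obtain rfl : m = m' := by
    rcases lt_trichotomy m m' with hl | hl | hl
    · have := hmono (show m + 1 ≤ m' from hl)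
      rw [blockStart_succ] at this; omega
    · exact hl
    · have := hmono (show m' + 1 ≤ m from hl)
      rw [blockStart_succ] at this; omega
  exact ⟨rfl, by omega⟩

namespace IsImage

variable {ψ : A → List B} {u : ℕ → A} {v : ℕ → B}

theorem occ_window (H : IsImage ψ u v) (m k : ℕ) :
    IsOccurrence v (wordImage ψ (window u m k)) (blockStart ψ u m) := by
  have := H (m + k)
  rw [window_append, wordImage_append, isOccurrence_append] at this
  simpa [blockStart] using this.2

theorem occ_block (H : IsImage ψ u v) (m : ℕ) :
    IsOccurrence v (ψ (u m)) (blockStart ψ u m) := by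
  simpa using H.occ_window m 1

theorem occ_wordImage (H : IsImage ψ u v) {w : List A} {m : ℕ} (h : IsOccurrence u w m) :
    IsOccurrence v (wordImage ψ w) (blockStart ψ u m) := by
  rw [← h]
  exact H.occ_window _ _

theorem apply_block (H : IsImage ψ u v) {m o : ℕ} (ho : o < (ψ (u m)).length) :
    v (blockStart ψ u m + o) = (ψ (u m))[o] :=
  isOccurrence_iff_getElem.1 (H.occ_block m) o ho

theorem window_eq (H : IsImage ψ u v) {m n : ℕ} (h : m ≤ n) :
    window v (blockStart ψ u m) (blockStart ψ u n - blockStart ψ u m) =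
      wordImage ψ (window u m (n - m)) := by
  obtain ⟨k, rfl⟩ := Nat.exists_eq_add_of_le h
  rw [blockStart_add]
  simpa [IsOccurrence] using H.occ_window m k

theorem comp {π : B → List C} {w : ℕ → C} (H : IsImage ψ u v) (hπ : IsImage π v w) :
    IsImage (fun a => wordImage π (ψ a)) u w := by
  intro m
  rw [← wordImage_wordImage, ← H m]
  exact hπ _

end IsImage

/-! ### Palindromes -/

theorem palindrome_iff_getElem {w : List A} : w.Palindrome ↔
    ∀ s t (h : s + t + 1 = w.length), w[s] = w[t] := by
  rw [List.Palindrome.iff_reverse_eq, List.ext_getElem_iff]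
  simp only [List.length_reverse, List.getElem_reverse, true_and]
  constructor
  · intro h s t hst
    simpa [show w.length - 1 - s = t by omega] using (h s (by omega) (by omega)).symm
  · intro h s hs _
    exact h _ _ (by omega)

theorem palindrome_window_iff {u : ℕ → A} {j n : ℕ} :
    (window u j n).Palindrome ↔ ∀ s t, s + t + 1 = n → u (j + s) = u (j + t) := by
  simp [palindrome_iff_getElem]

theorem palindrome_conj_iff {s z : List A} :
    (s ++ z ++ s.reverse).Palindrome ↔ z.Palindrome := by
  simp [List.Palindrome.iff_reverse_eq]

theorem reverse_wordImage {π : A → List B} (hπ : ∀ a, (π a).Palindrome) (w : List A) :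
    (wordImage π w).reverse = wordImage π w.reverse := by
  induction w with
  | nil => rfl
  | cons a w ih => simp [ih, (hπ a).reverse_eq]

theorem exists_eq_conj_of_mem {y : List A} (hy : y.Palindrome) {a : A} (ha : a ∈ y) :
    ∃ s t, a ∉ s ∧ (a :: t).Palindrome ∧ y = s ++ (a :: t) ++ s.reverse := by
  induction hy with
  | nil => simp at ha
  | singleton x =>
    obtain rfl : a = x := by simpa using ha
    exact ⟨[], [], by simp, .singleton a, rfl⟩
  | cons_concat x hl ih =>
    by_cases hx : a = x
    · subst hx
      exact ⟨[], _, by simp, .cons_concat a hl, by simp⟩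
    · obtain ⟨s, t, hs, hat, rfl⟩ := ih (by simpa [hx] using ha)
      exact ⟨x :: s, t, by simp [hx, hs], hat, by simp⟩

/-- The word between two consecutive elements of `P`, together with the next `k` letters, is a
palindrome. -/
def PalBetween (u : ℕ → A) (P : Set ℕ) (k : ℕ) : Prop :=
  ∀ j ∈ P, ∀ l ∈ P, j < l → (∀ i ∈ P, i ≤ j ∨ l ≤ i) →
    (window u (j + 1) (l - j - 1 + k)).Palindrome

/-- The word `y` occurs at position `j + 1`, between two letters of `T`. -/
def FramedOcc (u : ℕ → A) (T : Set A) (y : List A) (j : ℕ) : Prop :=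
  u j ∈ T ∧ IsOccurrence u y (j + 1) ∧ u (j + 1 + y.length) ∈ T

/-- Consecutive occurrences of `y` between letters of `T` span a palindrome. -/
def PalReturns (u : ℕ → A) (T : Set A) (y : List A) : Prop :=
  PalBetween u {j | FramedOcc u T y j} (y.length + 1)

/-- The word between two consecutive letters of `T` is a palindrome. -/
def PalGaps (u : ℕ → A) (T : Set A) : Prop :=
  PalBetween u {j | u j ∈ T} 0

/-! ### Morphisms with a marker -/

/-- The morphism `i ↦ a q(i)`. -/
abbrev marked (a : B) (q : A → List B) (i : A) : List B := a :: q i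

theorem marked_ne_nil (a : B) (q : A → List B) (i : A) : marked a q i ≠ [] :=
  List.cons_ne_nil _ _

/-- The morphism `i ↦ a q(i)` is marked by `a`: the words `q(i)` are distinct palindromes in
which the letter `a` does not occur. -/
structure IsMarked (a : B) (q : A → List B) : Prop where
  not_mem : ∀ i, a ∉ q i
  pal : ∀ i, (q i).Palindrome
  inj : Function.Injective q

namespace IsMarked

variable {a : B} {q : A → List B}

theorem wordImage_append_singleton (a : B) (q : A → List B) (x : List A) :
    wordImage (marked a q) x ++ [a] = a :: wordImage (fun i => q i ++ [a]) x := by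
  induction x with
  | nil => rfl
  | cons i x ih => simp [marked, ← ih]

theorem injective (hq : IsMarked a q) :
    Function.Injective fun x => wordImage (marked a q) x ++ [a] := by
  intro x y h
  simp only [wordImage_append_singleton, List.cons.injEq, true_and] at h
  refine wordImage_injective (by simp) (fun i j hij => ?_) h
  rcases List.prefix_concat_iff.1 hij with heq | hpre
  · exact hq.inj (List.append_cancel_right heq)
  · exact absurd (hpre.subset (by simp)) (hq.not_mem j)

theorem reverse_wordImage (hq : IsMarked a q) (x : List A) :
    (wordImage (marked a q) x ++ [a]).reverse = wordImage (marked a q) x.reverse ++ [a] := by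
  induction x with
  | nil => rfl
  | cons i x ih =>
    calc (wordImage (marked a q) (i :: x) ++ [a]).reverse
        = (wordImage (marked a q) x ++ [a]).reverse ++ ((q i).reverse ++ [a]) := by simp
      _ = wordImage (marked a q) (i :: x).reverse ++ [a] := by
        rw [ih, (hq.pal i).reverse_eq]
        simp [marked]

theorem palindrome_wordImage_iff (hq : IsMarked a q) {x : List A} :
    (wordImage (marked a q) x ++ [a]).Palindrome ↔ x.Palindrome := by
  rw [List.Palindrome.iff_reverse_eq, List.Palindrome.iff_reverse_eq, hq.reverse_wordImage]
  exact hq.injective.eq_iff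

end IsMarked

/-- `v` is the image of `u` under the marked morphism `i ↦ a q(i)`. -/
structure IsMarkedImage (a : B) (q : A → List B) (u : ℕ → A) (v : ℕ → B) : Prop
    extends IsMarked a q where
  image : IsImage (marked a q) u v

namespace IsMarkedImage

variable {a : B} {q : A → List B} {u : ℕ → A} {v : ℕ → B}

local notation "S" => blockStart (marked a q) u

theorem strictMono : StrictMono (blockStart (marked a q) u) :=
  blockStart_strictMono (marked_ne_nil a q) u

theorem start_succ (m : ℕ) : S (m + 1) = S m + 1 + (q (u m)).length := by
  rw [blockStart_succ, List.length_cons, Nat.add_right_comm, Nat.add_assoc]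

theorem start_lt_succ (m : ℕ) : S m < S (m + 1) := strictMono (Nat.lt_succ_self m)

theorem start_add_length_lt {m n : ℕ} (h : m < n) : S m + (q (u m)).length < S n := by
  have := strictMono.monotone (f := S) (show m + 1 ≤ n from h)
  rw [start_succ] at this
  omega

theorem apply_start (H : IsMarkedImage a q u v) (m : ℕ) : v (S m) = a :=
  (isOccurrence_cons.1 (H.image.occ_block m)).1

theorem occ_tail (H : IsMarkedImage a q u v) (m : ℕ) :
    IsOccurrence v (q (u m)) (S m + 1) :=
  (isOccurrence_cons.1 (H.image.occ_block m)).2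

theorem occ_tail_append (H : IsMarkedImage a q u v) (m : ℕ) :
    IsOccurrence v (q (u m) ++ [a]) (S m + 1) := by
  rw [isOccurrence_append, isOccurrence_singleton, ← start_succ]
  exact ⟨H.occ_tail m, H.apply_start _⟩

theorem apply_eq_iff (H : IsMarkedImage a q u v) {n : ℕ} : v n = a ↔ ∃ m, n = S m := by
  constructor
  · intro h
    obtain ⟨m, _ | o, rfl, ho⟩ := exists_block (marked_ne_nil a q) u n
    · exact ⟨m, rfl⟩
    · rw [H.image.apply_block ho, List.getElem_cons_succ] at h
      exact absurd (h ▸ List.getElem_mem _) (H.not_mem (u m))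
  · rintro ⟨m, rfl⟩
    exact H.apply_start m

theorem add_length_le_start (H : IsMarkedImage a q u v) {s : List B} (hs : a ∉ s) {j m : ℕ}
    (h : IsOccurrence v s j) (h1 : j ≤ S m) : j + s.length ≤ S m := by
  by_contra h2
  have := isOccurrence_iff_getElem.1 h (S m - j) (by omega)
  rw [show j + (S m - j) = S m by omega, H.apply_start] at this
  exact hs (this ▸ List.getElem_mem _)

theorem occ_image_start (H : IsMarkedImage a q u v) {x : List A} {m : ℕ}
    (h : IsOccurrence u x m) : IsOccurrence v (wordImage (marked a q) x ++ [a]) (S m) := by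
  rw [isOccurrence_append, isOccurrence_singleton, ← blockStart_add_length _ h]
  exact ⟨H.image.occ_wordImage h, H.apply_start _⟩

theorem occ_image_iff (H : IsMarkedImage a q u v) {x : List A} {n : ℕ} :
    IsOccurrence v (wordImage (marked a q) x ++ [a]) n ↔ ∃ m, n = S m ∧ IsOccurrence u x m := by
  refine ⟨fun h => ?_, fun ⟨m, hn, hm⟩ => hn ▸ H.occ_image_start hm⟩
  induction x generalizing n with
  | nil => simpa [isOccurrence_singleton, H.apply_eq_iff] using h
  | cons i x ih =>
    rw [wordImage_cons, List.append_assoc, isOccurrence_append, marked, isOccurrence_cons] at h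
    obtain ⟨⟨hn, hi⟩, hx⟩ := h
    obtain ⟨m, rfl⟩ := H.apply_eq_iff.1 hn
    obtain ⟨m', hm', hx'⟩ := ih hx
    rw [List.length_cons] at hm'
    have hlt : m < m' := strictMono.lt_iff_lt.1 (show S m < S m' by omega)
    have hle := H.add_length_le_start (H.not_mem i) hi (start_lt_succ m)
    have hmono := strictMono.monotone (f := S) (show m + 1 ≤ m' from hlt)
    obtain rfl : m' = m + 1 := strictMono.injective (show S m' = S (m + 1) by omega)
    rw [start_succ] at hm'
    exact ⟨m, rfl, isOccurrence_cons.2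
      ⟨H.inj ((H.occ_tail m).eq_of_length hi (by omega)), hx'⟩⟩

theorem exists_palindrome_of_mem (H : IsMarkedImage a q u v) {y : List B} (hy : y.Palindrome)
    (ha : a ∈ y) (hf : IsFactor v y) :
    ∃ s x, a ∉ s ∧ x.Palindrome ∧ y = s ++ (wordImage (marked a q) x ++ [a]) ++ s.reverse := by
  obtain ⟨j, hj⟩ := hf
  obtain ⟨s, t, hs, ht, rfl⟩ := exists_eq_conj_of_mem hy ha
  have hz : IsOccurrence v (a :: t) (j + s.length) :=
    (isOccurrence_append.1 (isOccurrence_append.1 hj).1).2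
  have hz' : IsOccurrence v (t.reverse ++ [a]) (j + s.length) := by
    rwa [← List.reverse_cons, ht.reverse_eq]
  obtain ⟨m, hm⟩ := H.apply_eq_iff.1 (isOccurrence_cons.1 hz).1
  obtain ⟨n, hn⟩ := H.apply_eq_iff.1
    (isOccurrence_singleton.1 (isOccurrence_append.1 hz').2)
  rw [List.length_reverse] at hn
  have hmn : m ≤ n := strictMono.le_iff_le.1 (show S m ≤ S n by omega)
  have hx : a :: t = wordImage (marked a q) (window u m (n - m)) ++ [a] := by
    rw [hm] at hz
    refine hz.eq_of_length (H.occ_image_start (isOccurrence_window _ _ _)) ?_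
    have := blockStart_add (marked a q) u m (n - m)
    rw [Nat.add_sub_cancel' hmn] at this
    simp only [List.length_append, List.length_cons, List.length_nil]
    omega
  refine ⟨s, window u m (n - m), hs, ?_, by rw [hx]⟩
  rwa [hx, H.palindrome_wordImage_iff] at ht

/-! ### Palindromes containing the marker -/

theorem occ_left_iff (H : IsMarkedImage a q u v) {b : B} {s : List B} (hs : a ∉ s) {j m : ℕ}
    (hj : j + 1 + s.length = S (m + 1)) :
    IsOccurrence v (b :: s) j ↔ b :: s <:+ marked a q (u m) := by
  have hend : j + (b :: s).length = S m + (marked a q (u m)).length := by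
    rw [← blockStart_succ, ← hj, List.length_cons, Nat.add_right_comm, Nat.add_assoc]
  constructor
  · intro h
    refine h.suffix_of_length_le (H.image.occ_block m) hend ?_
    by_contra hlen
    have := H.add_length_le_start hs (isOccurrence_cons.1 h).2 (show j + 1 ≤ S m by omega)
    have := start_lt_succ (a := a) (q := q) (u := u) m
    omega
  · exact fun h => (H.image.occ_block m).of_suffix h hend

theorem occ_right_iff (H : IsMarkedImage a q u v) {c : B} {s : List B} (hs : a ∉ s) {m : ℕ} :
    IsOccurrence v (s.reverse ++ [c]) (S m + 1) ↔ c :: s <:+ marked a q (u m) := by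
  have hrev : s.reverse ++ [c] <+: q (u m) ++ [a] ↔ c :: s <:+ marked a q (u m) := by
    rw [← List.reverse_suffix]
    simp [(H.pal (u m)).reverse_eq]
  rw [← hrev]
  refine ⟨fun h => ?_, (H.occ_tail_append m).of_prefix⟩
  have hle := H.add_length_le_start (by simpa) (isOccurrence_append.1 h).1 (start_lt_succ m)
  refine h.prefix_of_length_le (H.occ_tail_append m) ?_
  rw [start_succ] at hle
  simp only [List.length_append, List.length_reverse, List.length_singleton] at hle ⊢
  omega

/-- The letters `i` such that `s`, preceded by a letter of `T`, is a suffix of `a q(i)`. -/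
def framing (a : B) (q : A → List B) (T : Set B) (s : List B) : Set A :=
  {i | ∃ b ∈ T, b :: s <:+ marked a q i}

theorem framedOcc_image_iff (H : IsMarkedImage a q u v) {T : Set B} {s : List B} (hs : a ∉ s)
    {x : List A} {j : ℕ} :
    FramedOcc v T (s ++ (wordImage (marked a q) x ++ [a]) ++ s.reverse) j ↔
      ∃ m, j + 1 + s.length = S (m + 1) ∧ FramedOcc u (framing a q T s) x m := by
  have hframed : FramedOcc v T (s ++ (wordImage (marked a q) x ++ [a]) ++ s.reverse) j ↔
      ∃ b ∈ T, ∃ c ∈ T, IsOccurrence v (b :: s) j ∧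
        IsOccurrence v (wordImage (marked a q) x ++ [a]) (j + 1 + s.length) ∧
        IsOccurrence v (s.reverse ++ [c])
          (j + 1 + s.length + (wordImage (marked a q) x).length + 1) := by
    simp only [FramedOcc, isOccurrence_append, isOccurrence_cons, isOccurrence_nil,
      List.length_append, List.length_reverse, List.length_singleton, ← Nat.add_assoc]
    grind
  have hright : ∀ {m c}, IsOccurrence u x (m + 1) →
      (IsOccurrence v (s.reverse ++ [c]) (S (m + 1) + (wordImage (marked a q) x).length + 1) ↔
        c :: s <:+ marked a q (u (m + 1 + x.length))) := fun hx => by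
    rw [← blockStart_add_length _ hx, H.occ_right_iff hs]
  rw [hframed]
  constructor
  · rintro ⟨b, hb, c, hc, hbs, hx, hcs⟩
    obtain ⟨_ | m, hm, hx⟩ := H.occ_image_iff.1 hx
    · simp at hm
    rw [hm, hright hx] at hcs
    exact ⟨m, hm, ⟨b, hb, (H.occ_left_iff hs hm).1 hbs⟩, hx, c, hc, hcs⟩
  · rintro ⟨m, hm, ⟨b, hb, hbs⟩, hx, c, hc, hcs⟩
    refine ⟨b, hb, c, hc, (H.occ_left_iff hs hm).2 hbs, ?_⟩
    rw [hm, hright hx]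
    exact ⟨H.occ_image_start hx, hcs⟩

theorem palReturns_image (H : IsMarkedImage a q u v) {T : Set B} {s : List B} (hs : a ∉ s)
    {x : List A} (h : PalReturns u (framing a q T s) x) :
    PalReturns v T (s ++ (wordImage (marked a q) x ++ [a]) ++ s.reverse) := by
  intro j hj l hl hjl hb
  obtain ⟨m, hm, hmx⟩ := (H.framedOcc_image_iff hs).1 hj
  obtain ⟨n, hn, hnx⟩ := (H.framedOcc_image_iff hs).1 hl
  have hmn : m + 1 < n + 1 := strictMono.lt_iff_lt.1 (show S (m + 1) < S (n + 1) by omega)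
  have hpal := h m hmx n hnx (by omega) fun i hi => by
    by_contra! hmid
    have h1 : S (m + 1) < S (i + 1) := strictMono (by omega)
    have h2 : S (i + 1) < S (n + 1) := strictMono (by omega)
    have := hb (S (i + 1) - 1 - s.length)
      ((H.framedOcc_image_iff hs).2 ⟨i, by omega, hi⟩)
    omega
  set z := window u (m + 1) (n - m - 1 + (x.length + 1)) with hz
  have hlen : j + (wordImage (marked a q) z).length =
      l + (wordImage (marked a q) x).length := by
    have h1 := blockStart_add (marked a q) u (m + 1) (n - m - 1 + (x.length + 1))
    have h2 := blockStart_add_length (marked a q) hnx.2.1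
    rw [show m + 1 + (n - m - 1 + (x.length + 1)) = n + 1 + x.length by omega, h2,
      ← hz] at h1
    omega
  have hocc : IsOccurrence v (s ++ (wordImage (marked a q) z ++ [a]) ++ s.reverse) (j + 1) := by
    have hs₁ := (isOccurrence_append.1 (isOccurrence_append.1 hj.2.1).1).1
    have hs₂ := (isOccurrence_append.1 hl.2.1).2
    rw [isOccurrence_append, isOccurrence_append]
    refine ⟨⟨hs₁, hm ▸ H.occ_image_start (isOccurrence_window _ _ _)⟩, ?_⟩
    convert hs₂ using 1
    simp only [List.length_append, List.length_singleton]
    omega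
  refine hocc.palindrome_window (palindrome_conj_iff.2 (H.palindrome_wordImage_iff.2 hpal)) ?_
  simp only [List.length_append, List.length_singleton, List.length_reverse]
  omega

/-! ### Palindromes between two blocks -/

theorem occ_drop (H : IsMarkedImage a q u v) {m o : ℕ} (ho : o ≤ (q (u m)).length) :
    IsOccurrence v ((q (u m)).drop o) (S m + o + 1) :=
  (H.occ_tail m).of_suffix (List.drop_suffix _ _) (by simp; omega)

theorem occ_between (H : IsMarkedImage a q u v) {m n o : ℕ} (hmn : m < n)
    (ho : o ≤ (q (u m)).length) (t : ℕ) :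
    IsOccurrence v ((q (u m)).drop o ++
      (wordImage (marked a q) (window u (m + 1) (n - m - 1)) ++ [a]) ++ (q (u n)).take t)
      (S m + o + 1) := by
  have hlen := blockStart_add (marked a q) u (m + 1) (n - m - 1)
  rw [show m + 1 + (n - m - 1) = n by omega, start_succ] at hlen
  rw [isOccurrence_append, isOccurrence_append]
  refine ⟨⟨H.occ_drop ho, ?_⟩, ?_⟩
  · convert H.occ_image_start (isOccurrence_window u (m + 1) (n - m - 1)) using 1
    rw [List.length_drop, start_succ]
    omega
  · convert (H.occ_tail n).of_prefix (List.take_prefix t _) using 1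
    simp only [List.length_append, List.length_drop, List.length_singleton]
    omega

/-- The gap between two blocks whose letters in `u` enclose a palindrome is itself a palindrome as
soon as its two ends, cut out of these blocks, mirror each other. -/
theorem palBetween_of_offsets (H : IsMarkedImage a q u v) {P : Set ℕ} {O : A → Set ℕ} {k : ℕ}
    (hP : ∀ j, j ∈ P ↔ ∃ m, ∃ o ∈ O (u m), j = S m + o)
    (hO : ∀ i, ∀ o ∈ O i, o ≤ (q i).length ∧ 1 ≤ o + k ∧ o + k ≤ (q i).length + 1)
    (hgap : PalGaps u {i | (O i).Nonempty})
    (hsame : ∀ i, ∀ o ∈ O i, ∀ o' ∈ O i, o < o' → (∀ t ∈ O i, t ≤ o ∨ o' ≤ t) →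
      (((q i).drop o).take (o' - o - 1 + k)).Palindrome)
    (hdiff : ∀ i i' o o', IsGreatest (O i) o → IsLeast (O i') o' →
      (q i).drop o = ((q i').take (o' + k - 1)).reverse) :
    PalBetween v P k := by
  intro j hj l hl hjl hb
  obtain ⟨m, o, ho, rfl⟩ := (hP j).1 hj
  obtain ⟨n, o', ho', rfl⟩ := (hP l).1 hl
  have hbounds := hO _ o ho
  have hbounds' := hO _ o' ho'
  have hconsec : ∀ i, ∀ t ∈ O (u i), S i + t ≤ S m + o ∨ S n + o' ≤ S i + t :=
    fun i t ht => hb _ ((hP _).2 ⟨i, t, ht, rfl⟩)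
  rcases lt_trichotomy n m with hnm | rfl | hmn
  · have := start_add_length_lt (a := a) (q := q) (u := u) hnm
    omega
  · refine ((H.occ_drop hbounds.1).of_prefix (List.take_prefix _ _)).palindrome_window
      (hsame _ o ho o' ho' (by omega) fun t ht => ?_) ?_
    · have := hconsec n t ht
      omega
    · simp only [List.length_take, List.length_drop]
      omega
  · have hSmn := start_add_length_lt (a := a) (q := q) (u := u) hmn
    have hlast : IsGreatest (O (u m)) o := ⟨ho, fun t ht => by
      have := hconsec m t ht; have := hO _ t ht; omega⟩
    have hfirst : IsLeast (O (u n)) o' := ⟨ho', fun t ht => by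
      have := hconsec n t ht; omega⟩
    have hmid := hgap m ⟨o, ho⟩ n ⟨o', ho'⟩ hmn fun i ⟨t, ht⟩ => by
      by_contra! hi
      have := start_add_length_lt (a := a) (q := q) (u := u) hi.1
      have := start_add_length_lt (a := a) (q := q) (u := u) hi.2
      have := hconsec i t ht
      have := hO _ t ht
      omega
    refine (H.occ_between hmn hbounds.1 (o' + k - 1)).palindrome_window ?_ ?_
    · rw [hdiff _ _ _ _ hlast hfirst]
      nth_rewrite 2 [← List.reverse_reverse ((q (u n)).take (o' + k - 1))]
      exact palindrome_conj_iff.2 (H.palindrome_wordImage_iff.2 hmid)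
    · have hlen := blockStart_add (marked a q) u (m + 1) (n - m - 1)
      rw [show m + 1 + (n - m - 1) = n by omega, start_succ] at hlen
      simp only [List.length_append, List.length_singleton, List.length_drop, List.length_take]
      omega

theorem palGaps_singleton (H : IsMarkedImage a q u v) : PalGaps v {a} := by
  intro j hj l hl hjl hb
  obtain ⟨m, rfl⟩ := H.apply_eq_iff.1 hj
  obtain ⟨n, rfl⟩ := H.apply_eq_iff.1 hl
  obtain rfl : n = m + 1 := by
    have hlt : m < n := strictMono.lt_iff_lt.1 hjl
    have hmid : S (m + 1) ≤ S m ∨ S n ≤ S (m + 1) := hb _ (H.apply_start (m + 1))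
    rw [strictMono.le_iff_le, strictMono.le_iff_le] at hmid
    omega
  refine (H.occ_tail m).palindrome_window (H.pal _) ?_
  rw [start_succ]
  omega

theorem palGaps_image (H : IsMarkedImage a q u v) {T : Set B} (haT : a ∉ T) {T₀ : Set A}
    (hT : ∀ i, ∀ b ∈ q i, b ∈ T ↔ i ∈ T₀) (hne : ∀ i, q i ≠ []) (h : PalGaps u T₀) :
    PalGaps v T := by
  refine H.palBetween_of_offsets (O := fun i => {o | i ∈ T₀ ∧ 1 ≤ o ∧ o ≤ (q i).length})
    (fun j => ?_) (fun i o ho => ?_) ?_ (fun i o ho o' ho' hlt hb => ?_)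
    (fun i i' o o' ho ho' => ?_)
  · have hblock : ∀ m o, o < (q (u m)).length → (v (S m + (o + 1)) ∈ T ↔ u m ∈ T₀) := by
      intro m o ho
      rw [← hT (u m) _ (List.getElem_mem ho), H.image.apply_block (by simpa using ho),
        List.getElem_cons_succ]
    constructor
    · intro hj
      obtain ⟨m, _ | o, rfl, ho⟩ := exists_block (marked_ne_nil a q) u j
      · exact absurd (H.apply_start m ▸ hj) haT
      · have ho' := Nat.lt_of_succ_lt_succ ho
        exact ⟨m, o + 1, ⟨(hblock m o ho').1 hj, by omega, ho'⟩, rfl⟩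
    · rintro ⟨m, _ | o, ⟨hm, h1, h2⟩, rfl⟩
      · omega
      · exact (hblock m o h2).2 hm
  · exact ⟨ho.2.2, ho.2.1, by have := ho.2.2; omega⟩
  · have hnonempty : {i | {o | i ∈ T₀ ∧ 1 ≤ o ∧ o ≤ (q i).length}.Nonempty} = T₀ := Set.ext fun i =>
      ⟨fun ⟨o, ho⟩ => ho.1, fun hi => ⟨1, hi, le_rfl, List.length_pos_iff.2 (hne i)⟩⟩
    rwa [hnonempty]
  · have := hb (o + 1) ⟨ho.1, by omega, by have := ho'.2.2; omega⟩
    rw [show o' - o - 1 + 0 = 0 by omega, List.take_zero]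
    exact .nil
  · have h1 : (q i).length ≤ o :=
      ho.2 ⟨ho.1.1, List.length_pos_iff.2 (hne i), le_rfl⟩
    have h2 : o' ≤ 1 := ho'.2 ⟨ho'.1.1, le_rfl, List.length_pos_iff.2 (hne i')⟩
    rw [List.drop_eq_nil_of_le h1, show o' + 0 - 1 = 0 by omega, List.take_zero,
      List.reverse_nil]

/-! ### Palindromes without the marker -/

/-- The word `y` occurs between two letters of `T` in `a q(i) a`, the first of them being
at position `o`. -/
structure BlockOcc (a : B) (q : A → List B) (T : Set B) (y : List B) (i : A) (o : ℕ) : Prop where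
  add_le : o + y.length ≤ (q i).length
  prefix_drop : y <+: (q i).drop o
  left : ∃ b ∈ T, (marked a q i)[o]? = some b
  right : ∃ c ∈ T, (q i ++ [a])[o + y.length]? = some c

theorem framedOcc_start_add_iff (H : IsMarkedImage a q u v) {T : Set B} {y : List B} {m o : ℕ}
    (ho : o + y.length ≤ (q (u m)).length) :
    FramedOcc v T y (S m + o) ↔ BlockOcc a q T y (u m) o := by
  have hleft : (marked a q (u m))[o]? = some (v (S m + o)) := by
    rw [H.image.apply_block (by rw [List.length_cons]; omega), List.getElem?_eq_getElem]
  have hright : (q (u m) ++ [a])[o + y.length]? = some (v (S m + o + 1 + y.length)) := by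
    rw [List.getElem?_eq_getElem (by simp; omega),
      ← isOccurrence_iff_getElem.1 (H.occ_tail_append m) _ (by simp; omega)]
    congr 2; omega
  have hocc := H.occ_drop (show o ≤ (q (u m)).length by omega)
  constructor
  · rintro ⟨hb, hy, hc⟩
    exact ⟨ho, hy.prefix_of_length_le hocc (by simp; omega), ⟨_, hb, hleft⟩, ⟨_, hc, hright⟩⟩
  · rintro ⟨-, hy, ⟨b, hb, hbo⟩, ⟨c, hc, hco⟩⟩
    rw [hleft, Option.some_inj] at hbo
    rw [hright, Option.some_inj] at hco
    exact ⟨hbo ▸ hb, hocc.of_prefix hy, hco ▸ hc⟩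

theorem framedOcc_iff_blockOcc (H : IsMarkedImage a q u v) {T : Set B} {y : List B}
    (hy : a ∉ y) {j : ℕ} :
    FramedOcc v T y j ↔ ∃ m o, BlockOcc a q T y (u m) o ∧ j = S m + o := by
  constructor
  · intro h
    obtain ⟨m, o, rfl, ho⟩ := exists_block (marked_ne_nil a q) u j
    rw [List.length_cons] at ho
    have hle := H.add_length_le_start hy h.2.1 (m := m + 1) (by rw [start_succ]; omega)
    rw [start_succ] at hle
    exact ⟨m, o, (H.framedOcc_start_add_iff (by omega)).1 h, rfl⟩
  · rintro ⟨m, o, h, rfl⟩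
    exact (H.framedOcc_start_add_iff h.add_le).2 h

theorem palReturns_of_blockOcc (H : IsMarkedImage a q u v) {T : Set B} {y : List B}
    (hy : a ∉ y) (hgap : PalGaps u {i | ∃ o, BlockOcc a q T y i o})
    (hsame : ∀ i o o', o < o' → BlockOcc a q T y i o → BlockOcc a q T y i o' →
      (∀ t, BlockOcc a q T y i t → t ≤ o ∨ o' ≤ t) →
      (((q i).drop o).take (o' - o + y.length)).Palindrome)
    (hdiff : ∀ i i' o o', IsGreatest {o | BlockOcc a q T y i o} o →
      IsLeast {o | BlockOcc a q T y i' o} o' →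
      (q i).drop o = ((q i').take (o' + y.length)).reverse) :
    PalReturns v T y := by
  refine H.palBetween_of_offsets (O := fun i => {o | BlockOcc a q T y i o})
    (fun j => H.framedOcc_iff_blockOcc hy) (fun i o ho => ?_) hgap
    (fun i o ho o' ho' hlt hb => ?_) hdiff
  · have := BlockOcc.add_le ho
    omega
  · rw [show o' - o - 1 + (y.length + 1) = o' - o + y.length by omega]
    exact hsame i o o' hlt ho ho' hb

theorem BlockOcc.reflect {T : Set B} {y : List B} {i : A} {o : ℕ} (hy : y.Palindrome)
    (hq : (q i).Palindrome) (h : BlockOcc a q T y i o) :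
    BlockOcc a q T y i ((q i).length - y.length - o) := by
  have hle := h.add_le
  have hrev : (marked a q i).reverse = q i ++ [a] := by
    rw [List.reverse_cons, hq.reverse_eq]
  refine ⟨by omega, ?_, ?_, ?_⟩
  · obtain ⟨r, hr⟩ := h.prefix_drop
    refine ⟨((q i).take o).reverse, ?_⟩
    have hlen : (q i).length - y.length - o = r.length := by
      have := congrArg List.length hr
      simp at this; omega
    have hsplit : q i = r.reverse ++ (y ++ ((q i).take o).reverse) := by
      rw [← hy.reverse_eq, ← List.reverse_append, ← List.reverse_append, List.append_assoc, hr,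
        List.take_append_drop, hq.reverse_eq]
    rw [hlen]
    nth_rewrite 2 [hsplit]
    rw [List.drop_left' (by simp)]
  · obtain ⟨c, hc, hco⟩ := h.right
    refine ⟨c, hc, ?_⟩
    rw [← hco, ← hrev, List.getElem?_reverse (by simp; omega)]
    congr 1
    simp; omega
  · obtain ⟨b, hb, hbo⟩ := h.left
    refine ⟨b, hb, ?_⟩
    rw [← hbo, ← hrev, List.getElem?_reverse (by simp; omega)]
    congr 1
    simp; omega

/-- By symmetry, only the first occurrences in the blocks have to be compared. -/
theorem drop_eq_reverse_take_of_isLeast {T : Set B} {y : List B} (hy : y.Palindrome)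
    (hq : ∀ i, (q i).Palindrome)
    (hfirst : ∀ i i' o o', i ≠ i' → IsLeast {o | BlockOcc a q T y i o} o →
      IsLeast {o | BlockOcc a q T y i' o} o' →
      (q i).take (o + y.length) = (q i').take (o' + y.length))
    (i i' : A) (o o' : ℕ) (ho : IsGreatest {o | BlockOcc a q T y i o} o)
    (ho' : IsLeast {o | BlockOcc a q T y i' o} o') :
    (q i).drop o = ((q i').take (o' + y.length)).reverse := by
  have hle := BlockOcc.add_le ho.1
  have hreflect : IsLeast {o | BlockOcc a q T y i o} ((q i).length - y.length - o) := by
    refine ⟨BlockOcc.reflect hy (hq i) ho.1, fun t ht => ?_⟩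
    have := ho.2 (BlockOcc.reflect hy (hq i) ht)
    have := BlockOcc.add_le ht
    omega
  have hdrop : (q i).drop o =
      ((q i).take ((q i).length - y.length - o + y.length)).reverse := by
    rw [List.reverse_take, (hq i).reverse_eq]
    congr 1; omega
  rw [hdrop]
  congr 1
  by_cases hi : i = i'
  · subst hi
    rw [hreflect.unique ho']
  · exact hfirst i i' _ _ hi hreflect ho'

end IsMarkedImage

open IsMarkedImage

/-! ### Periodic sequences -/

/-- Equal letters of `p` are in equal or symmetric positions; for a palindrome this means that the
letters of its first half are distinct. -/
def MirrorDistinct (p : List B) : Prop :=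
  ∀ s t (hs : s < p.length) (ht : t < p.length), p[s] = p[t] → s = t ∨ s + t + 1 = p.length

/-- The periodic sequence `p p p ⋯`. -/
def periodic (p : List B) (hp : p ≠ []) (t : ℕ) : B :=
  p[t % p.length]'(Nat.mod_lt _ (List.length_pos_iff.2 hp))

theorem dvd_mod_add_mod_add_one_iff {N s t : ℕ} : N ∣ s % N + t % N + 1 ↔ N ∣ s + t + 1 := by
  rw [Nat.dvd_iff_mod_eq_zero, Nat.dvd_iff_mod_eq_zero]
  simp [Nat.add_mod]

section periodic

variable {p : List B} (hp : p ≠ [])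

theorem periodic_eq_of_dvd (hpal : p.Palindrome) {s t : ℕ} (h : p.length ∣ s + t + 1) :
    periodic p hp s = periodic p hp t := by
  have hpos := List.length_pos_iff.2 hp
  have hs := Nat.mod_lt s hpos
  have ht := Nat.mod_lt t hpos
  refine palindrome_iff_getElem.1 hpal _ _ ?_
  obtain ⟨k, hk⟩ := dvd_mod_add_mod_add_one_iff.2 h
  obtain rfl : k = 1 := by
    have hlt : p.length * k < p.length * 2 := by omega
    have := Nat.lt_of_mul_lt_mul_left hlt
    have : k ≠ 0 := by rintro rfl; omega
    omega
  omega

theorem periodic_eq_of_modEq {s t : ℕ} (h : s ≡ t [MOD p.length]) :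
    periodic p hp s = periodic p hp t := by
  unfold periodic
  congr 1

theorem modEq_or_dvd_of_periodic_eq (hm : MirrorDistinct p) {s t : ℕ}
    (h : periodic p hp s = periodic p hp t) :
    s ≡ t [MOD p.length] ∨ p.length ∣ s + t + 1 :=
  (hm _ _ _ _ h).imp_right fun h => dvd_mod_add_mod_add_one_iff.1 ⟨1, by omega⟩

theorem isOccurrence_periodic {j : ℕ} (hj : p.length ∣ j) :
    IsOccurrence (periodic p hp) p j := by
  obtain ⟨k, rfl⟩ := hj
  rw [isOccurrence_iff_getElem]
  intro t ht
  simp [periodic, Nat.mod_eq_of_lt ht]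

theorem isOccurrence_periodic_reflect (hpal : p.Palindrome) {y : List B} (hy : y.Palindrome)
    {o o' : ℕ} (ho : IsOccurrence (periodic p hp) y o) (h : p.length ∣ o + o' + y.length) :
    IsOccurrence (periodic p hp) y o' := by
  rw [isOccurrence_iff_getElem] at ho ⊢
  intro t ht
  have hmirror : periodic p hp (o' + t) = periodic p hp (o + (y.length - 1 - t)) :=
    periodic_eq_of_dvd hp hpal
      (by rwa [show o' + t + (o + (y.length - 1 - t)) + 1 = o + o' + y.length by omega])
  rw [hmirror, ho _ (by omega)]
  exact palindrome_iff_getElem.1 hy _ _ (by omega)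

theorem palindrome_window_periodic_of_dvd (hpal : p.Palindrome) {o n : ℕ}
    (h : p.length ∣ 2 * o + n) : (window (periodic p hp) o n).Palindrome :=
  palindrome_window_iff.2 fun s t hst => periodic_eq_of_dvd hp hpal
    (by rwa [show o + s + (o + t) + 1 = 2 * o + n by omega])

theorem palindrome_window_periodic_of_dvd_two (hpal : p.Palindrome) (h : p.length ∣ 2)
    (o n : ℕ) : (window (periodic p hp) o n).Palindrome := by
  rw [palindrome_window_iff]
  intro s t _
  rcases Nat.even_or_odd (s + t) with hst | hst
  · refine periodic_eq_of_modEq hp (Nat.ModEq.of_dvd h ?_)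
    rw [Nat.even_iff] at hst
    unfold Nat.ModEq
    omega
  · refine periodic_eq_of_dvd hp hpal (h.trans ?_)
    rw [Nat.odd_iff] at hst
    omega

/-- The reflected occurrence of `y` next to `o` bounds the distance of two consecutive occurrences
by the period; at a smaller distance, equal letters can only be symmetric. -/
theorem palindrome_window_periodic (hpal : p.Palindrome) (hm : MirrorDistinct p) {y : List B}
    (hy : y.Palindrome) (hy0 : y ≠ []) {o o' : ℕ} (hoo : o < o')
    (ho : IsOccurrence (periodic p hp) y o) (ho' : IsOccurrence (periodic p hp) y o')
    (hconsec : ∀ t, IsOccurrence (periodic p hp) y t → t ≤ o ∨ o' ≤ t) :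
    (window (periodic p hp) o (o' - o + y.length)).Palindrome := by
  by_cases hdvd : p.length ∣ o + o' + y.length
  · refine palindrome_window_periodic_of_dvd hp hpal ?_
    rwa [show 2 * o + (o' - o + y.length) = o + o' + y.length by omega]
  have hclose : o' - o < p.length := by
    have hmod := Nat.mod_lt (2 * o + y.length) (List.length_pos_iff.2 hp)
    have hreflect : p.length ∣
        o + (o + (p.length - (2 * o + y.length) % p.length)) + y.length := by
      refine ⟨(2 * o + y.length) / p.length + 1, ?_⟩
      have := Nat.mod_add_div (2 * o + y.length) p.length
      rw [Nat.mul_succ]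
      omega
    have hne : o' ≠ o + (p.length - (2 * o + y.length) % p.length) := by
      rintro rfl
      exact hdvd hreflect
    have := hconsec _ (isOccurrence_periodic_reflect hp hpal hy ho hreflect)
    omega
  have hsymm : ∀ t < y.length, p.length ∣ o + t + (o' + t) + 1 := by
    intro t ht
    have heq : periodic p hp (o + t) = periodic p hp (o' + t) := by
      rw [isOccurrence_iff_getElem.1 ho t ht, isOccurrence_iff_getElem.1 ho' t ht]
    refine (modEq_or_dvd_of_periodic_eq hp hm heq).resolve_left fun hmod => ?_
    have := Nat.eq_zero_of_dvd_of_lt ((Nat.modEq_iff_dvd' (by omega)).1 hmod) (by omega)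
    omega
  have hlen := List.length_pos_iff.2 hy0
  have hlen1 : y.length ≠ 1 := fun h1 => hdvd (by simpa [h1] using hsymm 0 hlen)
  refine palindrome_window_periodic_of_dvd_two hp hpal ((Nat.dvd_add_right (hsymm 0 hlen)).1 ?_) _ _
  rw [show o + 0 + (o' + 0) + 1 + 2 = o + 1 + (o' + 1) + 1 by omega]
  exact hsymm 1 (by omega)

end periodic

/-! ### The morphism `phi` followed by a code of palindromes -/

/-- The letter repeated after `0` in `phi n i`. -/
def next (n : ℕ) (i : Fin n) : Fin n :=
  ⟨min (i.val + 1) (n - 1), by omega⟩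

/-- The word `phi n i` without its first letter. -/
def phiTail (n : ℕ) (i : Fin n) : List (Fin n) :=
  List.replicate (if i.val + 1 < n then 1 else 2) (next n i)

@[simp] theorem val_next {n : ℕ} (i : Fin n) : (next n i).val = min (i.val + 1) (n - 1) := rfl

theorem phi_eq (n : ℕ) [NeZero n] (i : Fin n) : phi n i = marked 0 (phiTail n) i := by
  by_cases hi : i.val + 1 < n
  · have hnext : next n i = ⟨i.val + 1, hi⟩ := Fin.ext (min_eq_left (by omega))
    simp [phi, phiTail, hi, hnext]
  · have hnext : next n i = i := Fin.ext (by rw [val_next]; omega)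
    simp [phi, phiTail, hi, hnext, List.replicate_succ]

theorem phiTail_palindrome {n : ℕ} (i : Fin n) : (phiTail n i).Palindrome := by
  rw [List.Palindrome.iff_reverse_eq, phiTail, List.reverse_replicate]

theorem mem_phiTail {n : ℕ} {i b : Fin n} : b ∈ phiTail n i ↔ b = next n i := by
  rw [phiTail, List.mem_replicate, and_iff_right (by split <;> simp)]

/-- Nonempty palindromes, each with distinct letters in its first half, without common letters. -/
structure IsMirrorCode (π : A → List B) : Prop where
  ne_nil : ∀ i, π i ≠ []
  pal : ∀ i, (π i).Palindrome
  distinct : ∀ i, MirrorDistinct (π i)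
  disjoint : ∀ i j, i ≠ j → ∀ b ∈ π i, b ∉ π j

theorem isMirrorCode_singleton (A : Type*) : IsMirrorCode (fun a : A => [a]) where
  ne_nil := by simp
  pal i := .singleton i
  distinct i s t hs ht _ := by
    simp only [List.length_singleton] at hs ht
    omega
  disjoint i j hij b hb := by
    rw [List.mem_singleton] at hb ⊢
    exact fun hj => hij (hb ▸ hj)

/-- A subsingleton or a final segment: these sets of letters are stable under
`IsMarkedImage.framing`. -/
def IsSegment {n : ℕ} (T : Set (Fin n)) : Prop :=
  T.Subsingleton ∨ ∃ k, T = {i : Fin n | k ≤ i.val}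

theorem isSegment_of_next_eq {n : ℕ} {T : Set (Fin n)} (c : Fin n)
    (h : ∀ i ∈ T, next n i = c) : IsSegment T := by
  refine or_iff_not_imp_left.2 fun hT => ⟨n - 2, ?_⟩
  obtain ⟨i, hi, i', hi', hne⟩ := Set.not_subsingleton_iff.1 hT
  have hval : ∀ k ∈ T, min (k.val + 1) (n - 1) = c := fun k hk => congrArg Fin.val (h k hk)
  have hii' : i.val ≠ i'.val := fun h => hne (Fin.ext h)
  have := hval i hi
  have := hval i' hi'
  ext k
  simp only [Set.mem_ofPred_eq]
  constructor
  · intro hk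
    have := hval k hk
    omega
  · intro hk
    rcases show k.val = i.val ∨ k.val = i'.val by omega with h | h
    · rwa [Fin.ext h]
    · rwa [Fin.ext h]

/-- The image of `i` under `phi` and `π`, without the image of the first letter `0`. -/
abbrev tailImage {n : ℕ} (π : Fin n → List B) (i : Fin n) : List B := wordImage π (phiTail n i)

section tailImage

variable {n : ℕ} {π : Fin n → List B}

theorem tailImage_of_lt {i : Fin n} (h : i.val + 1 < n) : tailImage π i = π (next n i) := by
  simp [tailImage, phiTail, h]

theorem tailImage_of_not_lt {i : Fin n} (h : ¬ i.val + 1 < n) :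
    tailImage π i = π (next n i) ++ π (next n i) := by
  simp [tailImage, phiTail, h, List.replicate_succ]

theorem tailImage_eq_append_of_lt {i i' : Fin n} (hlt : i < i') (h : next n i = next n i') :
    tailImage π i' = tailImage π i ++ tailImage π i := by
  have hv := congrArg Fin.val h
  rw [val_next, val_next] at hv
  have : i.val < i'.val := hlt
  rw [tailImage_of_not_lt (i := i') (by omega), tailImage_of_lt (i := i) (by omega), h]

theorem next_eq_of_mem (hπ : IsMirrorCode π) {i : Fin n} {b : B} (h : b ∈ tailImage π i)
    {c : Fin n} (hc : b ∈ π c) : next n i = c := by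
  simp only [tailImage, wordImage, List.mem_flatMap, mem_phiTail] at h
  obtain ⟨_, rfl, h⟩ := h
  by_contra hne
  exact hπ.disjoint _ _ hne b h hc

theorem exists_mem_of_mem_tailImage {i : Fin n} {b : B} (h : b ∈ tailImage π i) :
    ∃ c, b ∈ π c := by
  obtain ⟨c, -, hc⟩ := List.mem_flatMap.1 h
  exact ⟨c, hc⟩

theorem isSegment_of_mem (hπ : IsMirrorCode π) {T : Set (Fin n)} (b : B)
    (h : ∀ i ∈ T, b ∈ tailImage π i) : IsSegment T := by
  rcases T.eq_empty_or_nonempty with rfl | ⟨i, hi⟩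
  · exact .inl Set.subsingleton_empty
  · obtain ⟨c, hc⟩ := exists_mem_of_mem_tailImage (h i hi)
    exact isSegment_of_next_eq c fun i hi => next_eq_of_mem hπ (h i hi) hc

theorem isOccurrence_tailImage (hπ : IsMirrorCode π) (i : Fin n) :
    IsOccurrence (periodic (π (next n i)) (hπ.ne_nil _)) (tailImage π i) 0 := by
  by_cases hi : i.val + 1 < n
  · rw [tailImage_of_lt hi]
    exact isOccurrence_periodic _ (dvd_zero _)
  · rw [tailImage_of_not_lt hi, isOccurrence_append]
    exact ⟨isOccurrence_periodic _ (dvd_zero _), isOccurrence_periodic _ (by simp)⟩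

theorem tailImage_palindrome (hπ : IsMirrorCode π) (i : Fin n) :
    (tailImage π i).Palindrome := by
  rw [List.Palindrome.iff_reverse_eq, reverse_wordImage hπ.pal, (phiTail_palindrome i).reverse_eq]

theorem tailImage_ne_nil (hπ : IsMirrorCode π) (i : Fin n) : tailImage π i ≠ [] := by
  by_cases hi : i.val + 1 < n
  · rw [tailImage_of_lt hi]
    exact hπ.ne_nil _
  · simp [tailImage_of_not_lt hi, hπ.ne_nil]

theorem tailImage_injective (hπ : IsMirrorCode π) : Function.Injective (tailImage π) := by
  refine Function.Injective.of_lt_imp_ne fun i i' hlt h => ?_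
  obtain ⟨b, hb⟩ := List.exists_mem_of_ne_nil _ (tailImage_ne_nil hπ i)
  obtain ⟨c, hc⟩ := exists_mem_of_mem_tailImage hb
  have hnext : next n i = next n i' :=
    (next_eq_of_mem hπ hb hc).trans (next_eq_of_mem hπ (h ▸ hb) hc).symm
  have happ := tailImage_eq_append_of_lt (π := π) hlt hnext
  rw [← h, List.self_eq_append_right] at happ
  exact tailImage_ne_nil hπ i happ

theorem isMarkedImage_phi (hπ : IsMirrorCode π) [NeZero n] (hn : 2 ≤ n) {a : B}
    (ha : π 0 = [a]) {u : ℕ → Fin n} {v : ℕ → B}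
    (h : IsImage (fun i => wordImage π (phi n i)) u v) :
    IsMarkedImage a (tailImage π) u v where
  not_mem i hi := by
    have := congrArg Fin.val (next_eq_of_mem hπ hi (c := 0) (by simp [ha]))
    simp at this
    omega
  pal := tailImage_palindrome hπ
  inj := tailImage_injective hπ
  image := by
    convert h using 2 with i
    simp [phi_eq, ha, marked]

/-! ### Returns in the image of a sequence under a code of palindromes -/

theorem blockOcc_univ_iff {a : B} {q : A → List B} {y : List B} {i : A} {o : ℕ} :
    BlockOcc a q Set.univ y i o ↔ o + y.length ≤ (q i).length ∧ y <+: (q i).drop o := by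
  refine ⟨fun h => ⟨h.add_le, h.prefix_drop⟩, fun ⟨hle, hy⟩ => ⟨hle, hy, ?_, ?_⟩⟩
  · exact ⟨_, trivial, List.getElem?_eq_getElem (by rw [List.length_cons]; omega)⟩
  · exact ⟨_, trivial, List.getElem?_eq_getElem (by simp; omega)⟩

theorem take_eq_take_of_isLeast {a : B} {q : A → List B} {y : List B} {i i' : A} {o o' : ℕ}
    (h : q i <+: q i') (ho : IsLeast {o | BlockOcc a q Set.univ y i o} o)
    (ho' : IsLeast {o | BlockOcc a q Set.univ y i' o} o') :
    (q i).take (o + y.length) = (q i').take (o' + y.length) := by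
  have hpre := fun t => h.drop t
  have hle := BlockOcc.add_le ho.1
  have h1 : o' ≤ o := ho'.2 (blockOcc_univ_iff.2
    ⟨hle.trans h.length_le, (BlockOcc.prefix_drop ho.1).trans (hpre o)⟩)
  have h2 : o ≤ o' := ho.2 (blockOcc_univ_iff.2 ⟨by omega,
    List.prefix_of_prefix_length_le (BlockOcc.prefix_drop ho'.1) (hpre o')
      (by rw [List.length_drop]; omega)⟩)
  obtain rfl := h1.antisymm h2
  exact (List.prefix_take_iff.2 ⟨(List.take_prefix _ _).trans h, by simp⟩).eq_of_length
    (by have := h.length_le; simp; omega)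

theorem mem_of_mem_framing {a : B} {q : A → List B} {T : Set B} {s : List B} {i : A} {b : B}
    (hb : b ∈ s) (hi : i ∈ framing a q T s) : b ∈ q i := by
  obtain ⟨c, -, hc⟩ := hi
  rcases List.suffix_cons_iff.1 hc with h | h
  · rwa [← (List.cons.inj h).2]
  · exact h.subset (List.mem_cons_of_mem _ hb)

theorem framing_univ_nil (a : B) (q : A → List B) : framing a q Set.univ [] = Set.univ :=
  Set.eq_univ_of_forall fun i =>
    ⟨_, trivial, _, List.dropLast_append_getLast (marked_ne_nil a q i)⟩

theorem isSegment_univ (n : ℕ) : IsSegment (Set.univ : Set (Fin n)) :=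
  .inr ⟨0, by simp⟩

theorem isSegment_framing_of_ne_nil (hπ : IsMirrorCode π) (a : B) (T : Set B) {s : List B}
    (hs : s ≠ []) : IsSegment (framing a (tailImage π) T s) := by
  obtain ⟨b, hb⟩ := List.exists_mem_of_ne_nil _ hs
  exact isSegment_of_mem hπ b fun i hi => mem_of_mem_framing hb hi

theorem isSegment_framing_univ (hπ : IsMirrorCode π) (a : B) (s : List B) :
    IsSegment (framing a (tailImage π) Set.univ s) := by
  rcases eq_or_ne s [] with rfl | hs
  · rw [framing_univ_nil]
    exact isSegment_univ n
  · exact isSegment_framing_of_ne_nil hπ a _ hs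

theorem palReturns_univ_nil (u : ℕ → A) : PalReturns u Set.univ [] := by
  intro j _ l _ hjl hb
  have : j + 1 ≤ j ∨ l ≤ j + 1 := hb (j + 1) ⟨trivial, rfl, trivial⟩
  rw [List.length_nil, show l - j - 1 + (0 + 1) = 1 by omega, window_one]
  exact .singleton _

theorem palReturns_univ_of_mem {a : B} {u : ℕ → Fin n} {v : ℕ → B} (hπ : IsMirrorCode π)
    (H : IsMarkedImage a (tailImage π) u v) {y : List B} (hy : y.Palindrome) (ha : a ∈ y)
    (hret : ∀ T : Set (Fin n), IsSegment T → ∀ x : List (Fin n), x.Palindrome →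
      x.length < y.length → PalReturns u T x) :
    PalReturns v Set.univ y := by
  intro j hj
  obtain ⟨s, x, hs, hx, rfl⟩ := H.exists_palindrome_of_mem hy ha ⟨_, hj.2.1⟩
  refine H.palReturns_image hs (hret _ (isSegment_framing_univ hπ a s) x hx ?_) j hj
  have := le_length_wordImage (marked_ne_nil a (tailImage π)) x
  simp only [List.length_append, List.length_singleton]
  omega

theorem palindrome_of_consecutive_blockOcc (hπ : IsMirrorCode π) {a : B} {y : List B}
    (hy : y.Palindrome) (hy0 : y ≠ []) {i : Fin n} {o o' : ℕ} (hoo : o < o')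
    (ho : BlockOcc a (tailImage π) Set.univ y i o)
    (ho' : BlockOcc a (tailImage π) Set.univ y i o')
    (hconsec : ∀ t, BlockOcc a (tailImage π) Set.univ y i t → t ≤ o ∨ o' ≤ t) :
    (((tailImage π i).drop o).take (o' - o + y.length)).Palindrome := by
  have hle := ho'.add_le
  have hdrop : ∀ t, t ≤ (tailImage π i).length →
      IsOccurrence (periodic (π (next n i)) (hπ.ne_nil _)) ((tailImage π i).drop t) t :=
    fun t ht => (isOccurrence_tailImage hπ i).of_suffix (List.drop_suffix _ _) (by simp; omega)
  have hlen : ((tailImage π i).drop o).take (o' - o + y.length) =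
      window (periodic (π (next n i)) (hπ.ne_nil _)) o (o' - o + y.length) :=
    ((hdrop o (by omega)).of_prefix (List.take_prefix _ _)).eq_of_length
      (isOccurrence_window _ _ _) (by simp; omega)
  rw [hlen]
  refine palindrome_window_periodic _ (hπ.pal _) (hπ.distinct _) hy hy0 hoo
    ((hdrop o (by omega)).of_prefix ho.prefix_drop)
    ((hdrop o' (by omega)).of_prefix ho'.prefix_drop) fun t ht => ?_
  by_contra! hmid
  refine absurd (hconsec t (blockOcc_univ_iff.2 ⟨by omega, ?_⟩)) (by omega)
  exact ht.prefix_of_length_le (hdrop t (by omega)) (by simp; omega)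

theorem palReturns_univ_of_not_mem {a : B} {u : ℕ → Fin n} {v : ℕ → B} (hπ : IsMirrorCode π)
    (H : IsMarkedImage a (tailImage π) u v) {y : List B} (hy : y.Palindrome) (hy0 : y ≠ [])
    (ha : a ∉ y) (hgap : ∀ T : Set (Fin n), IsSegment T → PalGaps u T) :
    PalReturns v Set.univ y := by
  obtain ⟨b, hb⟩ := List.exists_mem_of_ne_nil _ hy0
  have hmem : ∀ {i o}, BlockOcc a (tailImage π) Set.univ y i o → b ∈ tailImage π i :=
    fun h => List.mem_of_mem_drop (h.prefix_drop.subset hb)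
  refine H.palReturns_of_blockOcc ha (hgap _ ?_) (fun i o o' hoo ho ho' =>
    palindrome_of_consecutive_blockOcc hπ hy hy0 hoo ho ho')
    (drop_eq_reverse_take_of_isLeast hy H.pal fun i i' o o' hne ho ho' => ?_)
  · exact isSegment_of_mem hπ b fun i ⟨o, ho⟩ => hmem ho
  · obtain ⟨c, hc⟩ := exists_mem_of_mem_tailImage (hmem ho.1)
    have hnext : next n i = next n i' :=
      (next_eq_of_mem hπ (hmem ho.1) hc).trans (next_eq_of_mem hπ (hmem ho'.1) hc).symm
    rcases lt_or_gt_of_ne hne with hlt | hlt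
    · exact take_eq_take_of_isLeast
        (tailImage_eq_append_of_lt hlt hnext ▸ List.prefix_append _ _) ho ho'
    · exact (take_eq_take_of_isLeast
        (tailImage_eq_append_of_lt hlt hnext.symm ▸ List.prefix_append _ _) ho' ho).symm

theorem palReturns_univ {a : B} {u : ℕ → Fin n} {v : ℕ → B} (hπ : IsMirrorCode π)
    (H : IsMarkedImage a (tailImage π) u v)
    (hgap : ∀ T : Set (Fin n), IsSegment T → PalGaps u T) {y : List B} (hy : y.Palindrome)
    (hret : ∀ T : Set (Fin n), IsSegment T → ∀ x : List (Fin n), x.Palindrome →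
      x.length < y.length → PalReturns u T x) :
    PalReturns v Set.univ y := by
  rcases eq_or_ne y [] with rfl | hy0
  · exact palReturns_univ_nil v
  · by_cases ha : a ∈ y
    · exact palReturns_univ_of_mem hπ H hy ha hret
    · exact palReturns_univ_of_not_mem hπ H hy hy0 ha hgap

end tailImage

/-! ### The fixed point of `phi` -/

section fixedPoint

theorem isImage_uSeq (n : ℕ) [NeZero n] (hn : 2 ≤ n) : IsImage (phi n) (uSeq n) (uSeq n) := by
  have := isImage_seqImage (phi n) (phi_ne_nil n) (uSeq n)
  rwa [(seqImage_eq_self_iff n hn _).2 rfl] at this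

theorem wordImage_singleton (w : List A) : wordImage (fun i => [i]) w = w :=
  List.flatMap_singleton' w

theorem tailImage_singleton (n : ℕ) : tailImage (fun i : Fin n => [i]) = phiTail n :=
  funext fun _ => wordImage_singleton _

variable {n : ℕ}

theorem phiTail_ne_nil (i : Fin n) : phiTail n i ≠ [] :=
  List.ne_nil_of_mem (mem_phiTail.2 rfl)

theorem singleton_suffix_marked_phiTail [NeZero n] {i b : Fin n} :
    [b] <:+ marked 0 (phiTail n) i ↔ b = next n i := by
  obtain ⟨w, hw⟩ : ∃ w, marked 0 (phiTail n) i = w ++ [next n i] :=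
    ⟨_, by rw [marked, ← List.dropLast_append_getLast (phiTail_ne_nil i),
      mem_phiTail.1 (List.getLast_mem (phiTail_ne_nil i)), ← List.cons_append]⟩
  rw [hw, List.singleton_suffix_append_singleton_iff]

theorem isSegment_preimage_next {T : Set (Fin n)} (hT : IsSegment T) :
    IsSegment {i | next n i ∈ T} := by
  rcases hT with hT | ⟨k, rfl⟩
  · rcases hT.eq_empty_or_singleton with rfl | ⟨c, rfl⟩
    · exact .inl Set.subsingleton_empty
    · exact isSegment_of_next_eq c fun i hi => hi
  · by_cases hk : k < n
    · refine .inr ⟨k - 1, Set.ext fun i => ?_⟩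
      simp only [Set.mem_ofPred_eq, val_next]
      omega
    · refine .inl fun i hi => absurd hi ?_
      simp only [Set.mem_ofPred_eq, val_next]
      omega

theorem isSegment_framing [NeZero n] {T : Set (Fin n)} (hT : IsSegment T) (s : List (Fin n)) :
    IsSegment (framing 0 (phiTail n) T s) := by
  rcases eq_or_ne s [] with rfl | hs
  · simpa [framing, singleton_suffix_marked_phiTail] using isSegment_preimage_next hT
  · rw [← tailImage_singleton]
    exact isSegment_framing_of_ne_nil (isMirrorCode_singleton _) 0 T hs

theorem palGaps_empty (u : ℕ → A) : PalGaps u ∅ := fun _ hj => absurd hj (Set.notMem_empty _)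

theorem palGaps_univ (u : ℕ → A) : PalGaps u Set.univ := by
  intro j _ l _ hjl hb
  have : j + 1 ≤ j ∨ l ≤ j + 1 := hb (j + 1) trivial
  rw [show l - j - 1 + 0 = 0 by omega]
  exact .nil

variable [NeZero n]

theorem isMarkedImage_uSeq (hn : 2 ≤ n) :
    IsMarkedImage 0 (phiTail n) (uSeq n) (uSeq n) := by
  rw [← tailImage_singleton]
  refine isMarkedImage_phi (isMirrorCode_singleton _) hn rfl ?_
  simpa only [wordImage_singleton] using isImage_uSeq n hn

theorem palGaps_of_preimage_next (hn : 2 ≤ n) {T : Set (Fin n)} (h0 : (0 : Fin n) ∉ T)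
    (h : PalGaps (uSeq n) {i | next n i ∈ T}) : PalGaps (uSeq n) T := by
  refine (isMarkedImage_uSeq hn).palGaps_image h0 (fun i b hb => ?_) phiTail_ne_nil h
  rw [mem_phiTail.1 hb]
  rfl

theorem palGaps_le_val (hn : 2 ≤ n) (k : ℕ) : PalGaps (uSeq n) {i | k ≤ i.val} := by
  induction k with
  | zero => simpa using palGaps_univ (uSeq n)
  | succ k ih =>
    by_cases hk : k + 1 < n
    · refine palGaps_of_preimage_next hn (by simp) ?_
      convert ih using 3
      simp only [Set.mem_ofPred_eq, val_next]
      omega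
    · convert palGaps_empty (uSeq n)
      refine Set.eq_empty_of_forall_notMem fun i => ?_
      simp only [Set.mem_ofPred_eq]
      omega

theorem palGaps_val_eq (hn : 2 ≤ n) (c : ℕ) : PalGaps (uSeq n) {i | i.val = c} := by
  induction c with
  | zero => simpa [Fin.val_eq_zero_iff] using (isMarkedImage_uSeq hn).palGaps_singleton
  | succ c ih =>
    by_cases hc : c + 2 < n
    · refine palGaps_of_preimage_next hn (by simp) ?_
      convert ih using 3
      simp only [Set.mem_ofPred_eq, val_next]
      omega
    · by_cases hc' : c + 2 = n
      · convert palGaps_le_val hn (c + 1) using 3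
        omega
      · convert palGaps_empty (uSeq n)
        refine Set.eq_empty_of_forall_notMem fun i => ?_
        simp only [Set.mem_ofPred_eq]
        omega

theorem palGaps_uSeq (hn : 2 ≤ n) {T : Set (Fin n)} (hT : IsSegment T) :
    PalGaps (uSeq n) T := by
  rcases hT with hT | ⟨k, rfl⟩
  · rcases hT.eq_empty_or_singleton with rfl | ⟨c, rfl⟩
    · exact palGaps_empty _
    · simpa [Fin.val_inj] using palGaps_val_eq hn c.val
  · exact palGaps_le_val hn k

end fixedPoint

/-! ### Returns in the fixed point of `phi` -/

section returns

theorem IsMarkedImage.BlockOcc.eq_of_subset_singleton {a : B} {q : A → List B} {T : Set B}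
    {y : List B} {i : A} {o : ℕ} (h : BlockOcc a q T y i o) (hT : T ⊆ {a}) (ha : a ∉ q i) :
    o = 0 ∧ y = q i := by
  have hle := h.add_le
  obtain ⟨b, hb, hbo⟩ := h.left
  obtain ⟨c, hc, hco⟩ := h.right
  obtain rfl : b = a := hT hb
  obtain rfl : c = b := hT hc
  obtain rfl : o = 0 := by
    rcases o with _ | o
    · rfl
    · exact absurd (List.mem_of_getElem? (by simpa using hbo)) ha
  refine ⟨rfl, h.prefix_drop.eq_of_length ?_⟩
  by_contra hne
  rw [List.drop_zero] at hne
  rw [List.getElem?_append_left (by omega)] at hco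
  exact ha (List.mem_of_getElem? hco)

theorem IsMarkedImage.BlockOcc.pos_and_lt_of_not_mem {a : B} {q : A → List B} {T : Set B}
    {y : List B} {i : A} {o : ℕ} (h : BlockOcc a q T y i o) (ha : a ∉ T) :
    0 < o ∧ o + y.length < (q i).length := by
  obtain ⟨b, hb, hbo⟩ := h.left
  obtain ⟨c, hc, hco⟩ := h.right
  constructor
  · refine Nat.pos_of_ne_zero fun h0 => ha ?_
    subst h0
    rwa [show a = b by simpa using hbo]
  · refine lt_of_le_of_ne h.add_le fun hlen => ha ?_
    rwa [show a = c by simpa [hlen] using hco]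

variable {n : ℕ} [NeZero n]

theorem IsSegment.subset_singleton_zero_or {T : Set (Fin n)} (hT : IsSegment T)
    (hT' : T ≠ Set.univ) : T ⊆ {0} ∨ (0 : Fin n) ∉ T := by
  refine or_iff_not_imp_right.2 fun h0 => ?_
  rw [not_not] at h0
  rcases hT with hT | ⟨k, rfl⟩
  · exact fun b hb => hT hb h0
  · obtain rfl : k = 0 := by simpa using h0
    simp at hT'

theorem blockOcc_phiTail_unique (hn : 2 ≤ n) {T : Set (Fin n)} (hT : IsSegment T)
    (hT' : T ≠ Set.univ) {y : List (Fin n)} {i i' : Fin n} {o o' : ℕ}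
    (h : BlockOcc 0 (phiTail n) T y i o) (h' : BlockOcc 0 (phiTail n) T y i' o') :
    i = i' ∧ o = o' := by
  have H := isMarkedImage_uSeq hn
  rcases hT.subset_singleton_zero_or hT' with h0 | h0
  · obtain ⟨ho, hy⟩ := h.eq_of_subset_singleton h0 (H.not_mem i)
    obtain ⟨ho', hy'⟩ := h'.eq_of_subset_singleton h0 (H.not_mem i')
    exact ⟨H.inj (hy.symm.trans hy'), ho.trans ho'.symm⟩
  · have hlast : ∀ {i o}, BlockOcc 0 (phiTail n) T y i o → i.val + 1 = n ∧ o = 1 := by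
      intro i o h
      have hpos := h.pos_and_lt_of_not_mem h0
      rw [phiTail, List.length_replicate] at hpos
      split at hpos <;> omega
    have := hlast h
    have := hlast h'
    exact ⟨Fin.ext (by omega), by omega⟩

theorem palReturns_uSeq_of_not_mem (hn : 2 ≤ n) {T : Set (Fin n)} (hT : IsSegment T)
    (hT' : T ≠ Set.univ) {y : List (Fin n)} (hy : y.Palindrome) (h0 : 0 ∉ y) :
    PalReturns (uSeq n) T y := by
  have H := isMarkedImage_uSeq hn
  refine H.palReturns_of_blockOcc h0 (palGaps_uSeq hn (.inl ?_)) ?_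
    (drop_eq_reverse_take_of_isLeast hy H.pal ?_)
  · rintro i ⟨o, h⟩ i' ⟨o', h'⟩
    exact (blockOcc_phiTail_unique hn hT hT' h h').1
  · intro i o o' hoo h h' _
    exact absurd (blockOcc_phiTail_unique hn hT hT' h h').2 hoo.ne
  · intro i i' o o' hne h h'
    exact absurd (blockOcc_phiTail_unique hn hT hT' h.1 h'.1).1 hne

theorem palReturns_uSeq (hn : 2 ≤ n) {T : Set (Fin n)} (hT : IsSegment T) {y : List (Fin n)}
    (hy : y.Palindrome) : PalReturns (uSeq n) T y := by
  have H := isMarkedImage_uSeq hn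
  induction hN : y.length using Nat.strong_induction_on generalizing T y with
  | _ N ih =>
  subst hN
  have hret : ∀ T : Set (Fin n), IsSegment T → ∀ x : List (Fin n), x.Palindrome →
      x.length < y.length → PalReturns (uSeq n) T x :=
    fun T hT x hx hlt => ih _ hlt hT hx rfl
  rcases eq_or_ne T Set.univ with rfl | hT'
  · exact palReturns_univ (isMirrorCode_singleton _) ((tailImage_singleton n).symm ▸ H)
      (fun T => palGaps_uSeq hn) hy hret
  by_cases h0 : 0 ∈ y
  · intro j hj
    obtain ⟨s, x, hs, hx, rfl⟩ := H.exists_palindrome_of_mem hy h0 ⟨_, hj.2.1⟩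
    refine H.palReturns_image hs (hret _ (isSegment_framing hT s) x hx ?_) j hj
    have := le_length_wordImage (marked_ne_nil 0 (phiTail n)) x
    simp only [List.length_append, List.length_singleton]
    omega
  · exact palReturns_uSeq_of_not_mem hn hT hT' hy h0

theorem palReturns_image_uSeq (hn : 2 ≤ n) {π : Fin n → List B} (hπ : IsMirrorCode π) {a : B}
    (ha : π 0 = [a]) {v : ℕ → B} (h : IsImage π (uSeq n) v) {y : List B} (hy : y.Palindrome) :
    PalReturns v Set.univ y :=
  palReturns_univ hπ (isMarkedImage_phi hπ hn ha ((isImage_uSeq n hn).comp h))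
    (fun _ => palGaps_uSeq hn) hy fun _ hT _ hx _ => palReturns_uSeq hn hT hx

end returns

/-! ### Richness -/

section richness

theorem finite_palindromicFactors (w : List A) : {p | p <:+: w ∧ p.Palindrome}.Finite :=
  (List.finite_toSet w.sublists).subset fun _ hp => List.mem_sublists.2 hp.1.sublist

theorem infix_of_palindromic_suffix {w p y : List A} {b : A} (hp : p.Palindrome)
    (hy : y.Palindrome) (hpy : p <:+ y) (hlt : p.length < y.length) (hyw : y <:+ w ++ [b]) :
    p <:+: w := by
  have hpre : p <+: y := by rwa [← List.reverse_suffix, hp.reverse_eq, hy.reverse_eq]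
  rcases List.suffix_concat_iff.1 hyw with rfl | ⟨t, rfl, ht⟩
  · simp at hlt
  · rcases List.prefix_concat_iff.1 hpre with rfl | hpt
    · exact absurd hlt (lt_irrefl _)
    · exact hpt.isInfix.trans ht.isInfix

theorem palindromicFactors_append_singleton {w y : List A} {b : A} (hy : y.Palindrome)
    (hsuf : y <:+ w ++ [b])
    (hmax : ∀ p, p <:+ w ++ [b] → p.Palindrome → p.length ≤ y.length) :
    {p | p <:+: w ++ [b] ∧ p.Palindrome} = insert y {p | p <:+: w ∧ p.Palindrome} := by
  ext p
  simp only [Set.mem_ofPred_eq, Set.mem_insert_iff]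
  constructor
  · rintro ⟨hpw, hp⟩
    rcases List.infix_concat_iff.1 hpw with h | h
    · have hpy := List.suffix_of_suffix_length_le h hsuf (hmax p h hp)
      rcases hpy.length_le.eq_or_lt with hl | hl
      · exact .inl (hpy.eq_of_length hl)
      · exact .inr ⟨infix_of_palindromic_suffix hp hy hpy hl hsuf, hp⟩
    · exact .inr ⟨h, hp⟩
  · rintro (rfl | ⟨hpw, hp⟩)
    · exact ⟨hsuf.isInfix, hy⟩
    · exact ⟨hpw.trans (List.prefix_append _ _).isInfix, hp⟩

theorem not_infix_of_palReturns {v : ℕ → A} {w y : List A} {b : A} {J : ℕ} (hJ : 1 ≤ J)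
    (hw : IsOccurrence v (w ++ [b]) J) (hy : PalReturns v Set.univ y) (hsuf : y <:+ w ++ [b])
    (hmax : ∀ p, p <:+ w ++ [b] → p.Palindrome → p.length ≤ y.length) : ¬ y <:+: w := by
  classical
  rintro ⟨s, t, hst⟩
  obtain ⟨z, hz⟩ := hsuf
  have hzlen := congrArg List.length hz
  have hslen := congrArg List.length hst
  simp only [List.length_append, List.length_singleton] at hzlen hslen
  set l := J + z.length with hl
  have hyl : IsOccurrence v y l := by
    rw [← hz, isOccurrence_append] at hw
    exact hw.2
  have hys : IsOccurrence v y (J + s.length) := by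
    have hww := (isOccurrence_append.1 hw).1
    rw [← hst, isOccurrence_append, isOccurrence_append] at hww
    exact hww.1.2
  obtain ⟨k, hyk, hsk, hkl, hlast⟩ : ∃ k, IsOccurrence v y k ∧ J + s.length ≤ k ∧ k < l ∧
      ∀ i, IsOccurrence v y i → i < l → i ≤ k := by
    have hle : J + s.length ≤ l - 1 := by omega
    refine ⟨Nat.findGreatest (IsOccurrence v y) (l - 1), Nat.findGreatest_spec hle hys,
      Nat.le_findGreatest hle hys, ?_, fun i hi hil => Nat.le_findGreatest (by omega) hi⟩
    have := Nat.findGreatest_le (P := IsOccurrence v y) (l - 1)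
    omega
  have hpal := hy (k - 1) ⟨trivial, by rwa [Nat.sub_add_cancel (by omega)], trivial⟩
    (l - 1) ⟨trivial, by rwa [Nat.sub_add_cancel (by omega)], trivial⟩ (by omega) (by
      rintro i ⟨-, hi, -⟩
      by_contra! hik
      have := hlast (i + 1) hi (by omega)
      omega)
  rw [Nat.sub_add_cancel (by omega), show l - 1 - (k - 1) - 1 + (y.length + 1) =
    l - k + y.length by omega] at hpal
  have hlen := hmax _ ((isOccurrence_window v k (l - k + y.length)).suffix_of_length_le hw
    (by simp; omega) (by simp; omega)) hpal
  rw [length_window] at hlen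
  omega

theorem isRichWord_of_palReturns {v : ℕ → A}
    (hv : ∀ y : List A, y.Palindrome → PalReturns v Set.univ y) {w : List A} {J : ℕ}
    (hJ : 1 ≤ J) (hw : IsOccurrence v w J) : IsRichWord w := by
  induction w using List.reverseRecOn with
  | nil =>
    have : {p : List A | p <:+: [] ∧ p.Palindrome} = {[]} :=
      Set.ext fun p => ⟨fun h => List.infix_nil.1 h.1, by rintro rfl; exact ⟨List.infix_rfl, .nil⟩⟩
    rw [IsRichWord, this, Set.ncard_singleton, List.length_nil]
  | append_singleton w b ih =>
    obtain ⟨y, ⟨hsuf, hy⟩, hmax⟩ := Set.exists_max_image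
      {p | p <:+ w ++ [b] ∧ p.Palindrome} List.length
      ((finite_palindromicFactors (w ++ [b])).subset fun p hp => ⟨hp.1.isInfix, hp.2⟩)
      ⟨[], List.nil_suffix, .nil⟩
    have hmax' : ∀ p, p <:+ w ++ [b] → p.Palindrome → p.length ≤ y.length :=
      fun p hp hpal => hmax p ⟨hp, hpal⟩
    have hnew := not_infix_of_palReturns hJ hw (hv y hy) hsuf hmax'
    rw [IsRichWord, palindromicFactors_append_singleton hy hsuf hmax',
      Set.ncard_insert_of_notMem (fun h => hnew h.1) (finite_palindromicFactors w),
      ih (isOccurrence_append.1 hw).1, List.length_append, List.length_singleton]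

variable {n : ℕ} [NeZero n]

theorem isOccurrence_uSeq_window_zero (hn : 2 ≤ n) (k : ℕ) :
    ∃ p, 1 ≤ p ∧ IsOccurrence (uSeq n) (window (uSeq n) 0 k) p := by
  have himg := isImage_uSeq n hn
  have hmono := blockStart_strictMono (phi_ne_nil n) (uSeq n)
  induction k with
  | zero => exact ⟨1, le_rfl, rfl⟩
  | succ k ih =>
    rcases k with _ | k
    · have H := isMarkedImage_uSeq (n := n) hn
      refine ⟨blockStart (marked 0 (phiTail n)) (uSeq n) 1, start_lt_succ 0, ?_⟩
      rw [Nat.zero_add, window_one, isOccurrence_singleton, H.apply_start]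
      exact (H.apply_start 0).symm
    · obtain ⟨p, hp, h⟩ := ih
      refine ⟨blockStart (phi n) (uSeq n) p, (Nat.zero_le _).trans_lt (hmono hp),
        (himg.occ_wordImage h).of_prefix ?_⟩
      have hlen := two_mul_length_le n (window (uSeq n) 0 (k + 1))
      rw [length_window] at hlen
      exact (isOccurrence_window _ _ _).prefix_of_length_le (himg (k + 1))
        (by rw [length_window]; omega)

theorem isRichSeq_image_uSeq (hn : 2 ≤ n) {π : Fin n → List B} (hπ : IsMirrorCode π) {a : B}
    (ha : π 0 = [a]) {v : ℕ → B} (h : IsImage π (uSeq n) v) : IsRichSeq v := by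
  rintro w ⟨j, hj⟩
  obtain ⟨p, hp, ho⟩ := isOccurrence_uSeq_window_zero (n := n) hn (j + w.length)
  have hlen := le_length_wordImage hπ.ne_nil (window (uSeq n) 0 (j + w.length))
  rw [length_window] at hlen
  have hocc := (h.occ_wordImage ho).of_prefix
    ((isOccurrence_window v 0 (j + w.length)).prefix_of_length_le (h _) (by rwa [length_window]))
  rw [window_append, Nat.zero_add, hj, isOccurrence_append] at hocc
  have hstart : 0 < blockStart π (uSeq n) p := blockStart_strictMono hπ.ne_nil (uSeq n) hp
  exact isRichWord_of_palReturns (fun y hy => palReturns_image_uSeq hn hπ ha h hy) (by omega)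
    hocc.2

end richness

/-! ### Bispecial factors and return words -/

/-- The positions `p` and `p'` of `ψ(u)` have the same offset in two blocks `ψ(a)` of the same
letter `a` of `u`. -/
def Aligned (ψ : A → List B) (u : ℕ → A) (p p' : ℕ) : Prop :=
  ∃ m m' o, u m = u m' ∧ o < (ψ (u m)).length ∧ p = blockStart ψ u m + o ∧
    p' = blockStart ψ u m' + o

/-- All occurrences of `w` in `v = ψ(u)` are cut in the same way by the blocks `ψ(a)`. -/
def IsSynchronized (ψ : A → List B) (u : ℕ → A) (v : ℕ → B) (w : List B) : Prop :=
  ∀ p p', IsOccurrence v w p → IsOccurrence v w p' →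
    ∀ t < w.length, Aligned ψ u (p + t) (p' + t)

/-- All occurrences of `ψ(w)` in `v = ψ(u)` come from occurrences of `w` in `u`. -/
def LiftsOccurrences (ψ : A → List B) (u : ℕ → A) (v : ℕ → B) (w : List A) : Prop :=
  ∀ p, IsOccurrence v (wordImage ψ w) p → ∃ m, p = blockStart ψ u m ∧ IsOccurrence u w m

section synchronization

variable {ψ : A → List B} {u : ℕ → A} {v : ℕ → B} {p p' : ℕ}

namespace Aligned

theorem exists_blockStart (hψ : ∀ a, ψ a ≠ []) (h : Aligned ψ u p p')
    (hp : ∃ m, p = blockStart ψ u m) : ∃ m, p' = blockStart ψ u m := by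
  obtain ⟨k, k', o, -, ho, rfl, rfl⟩ := h
  obtain ⟨m, hm⟩ := hp
  obtain ⟨-, rfl⟩ := block_unique (o' := 0) hψ hm ho (List.length_pos_iff.2 (hψ _))
  exact ⟨k', rfl⟩

theorem exists_blockStart_succ (hψ : ∀ a, ψ a ≠ []) (h : Aligned ψ u p p')
    (hp : ∃ m, p + 1 = blockStart ψ u m) : ∃ m, p' + 1 = blockStart ψ u m := by
  obtain ⟨k, k', o, hu, ho, rfl, rfl⟩ := h
  obtain ⟨m, hm⟩ := hp
  by_cases hlt : o + 1 < (ψ (u k)).length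
  · exact absurd (block_unique (o' := 0) hψ hm hlt (List.length_pos_iff.2 (hψ _))).2 (by omega)
  · refine ⟨k' + 1, ?_⟩
    rw [blockStart_succ, ← hu]
    omega

theorem exists_blockStart_of_apply_ne (H : IsImage ψ u v) (h : Aligned ψ u (p + 1) (p' + 1))
    (hne : v p ≠ v p') : ∃ m, p + 1 = blockStart ψ u m := by
  obtain ⟨k, k', o, hu, ho, hp, hp'⟩ := h
  rcases o with _ | o
  · exact ⟨k, hp⟩
  · refine absurd ?_ hne
    rw [show p = blockStart ψ u k + o by omega, show p' = blockStart ψ u k' + o by omega,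
      H.apply_block (by omega), H.apply_block (by rw [← hu]; omega)]
    simp only [hu]

theorem exists_blockStart_succ_of_apply_ne (H : IsImage ψ u v) (h : Aligned ψ u p p')
    (hne : v (p + 1) ≠ v (p' + 1)) : ∃ m, p + 1 = blockStart ψ u m := by
  obtain ⟨k, k', o, hu, ho, rfl, rfl⟩ := h
  by_cases hlt : o + 1 < (ψ (u k)).length
  · refine absurd ?_ hne
    rw [Nat.add_assoc, Nat.add_assoc, H.apply_block hlt, H.apply_block (by rwa [← hu])]
    simp only [hu]
  · exact ⟨k + 1, by rw [blockStart_succ]; omega⟩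

end Aligned

namespace IsSynchronized

variable {w : List B}

theorem exists_start_of_isLeftSpecial (hψ : ∀ a, ψ a ≠ []) (H : IsImage ψ u v)
    (h : IsSynchronized ψ u v w) (hw : 0 < w.length) (hs : IsLeftSpecial v w)
    (hp : IsOccurrence v w p) : ∃ m, p = blockStart ψ u m := by
  obtain ⟨-, b, c, hbc, ⟨j, hj⟩, ⟨l, hl⟩⟩ := hs
  rw [isOccurrence_cons] at hj hl
  exact (h _ _ hj.2 hp 0 hw).exists_blockStart hψ
    ((h _ _ hj.2 hl.2 0 hw).exists_blockStart_of_apply_ne H (by rwa [hj.1, hl.1]))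

theorem exists_end_of_isRightSpecial (hψ : ∀ a, ψ a ≠ []) (H : IsImage ψ u v)
    (h : IsSynchronized ψ u v w) (hw : 0 < w.length) (hs : IsRightSpecial v w)
    (hp : IsOccurrence v w p) : ∃ m, p + w.length = blockStart ψ u m := by
  obtain ⟨-, b, c, hbc, ⟨j, hj⟩, ⟨l, hl⟩⟩ := hs
  rw [isOccurrence_append, isOccurrence_singleton] at hj hl
  obtain ⟨t, ht⟩ := Nat.exists_eq_add_of_lt hw
  rw [Nat.zero_add] at ht
  rw [ht] at hj hl ⊢
  exact (h _ _ hj.1 hp t (by omega)).exists_blockStart_succ hψ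
    ((h _ _ hj.1 hl.1 t (by omega)).exists_blockStart_succ_of_apply_ne H
      (by rwa [Nat.add_assoc, Nat.add_assoc, hj.2, hl.2]))

end IsSynchronized

theorem exists_liftsOccurrences (hψ : ∀ a, ψ a ≠ []) (hinj : Function.Injective (wordImage ψ))
    (H : IsImage ψ u v) {w' : List B} (hw : IsFactor v w')
    (hstart : ∀ p, IsOccurrence v w' p → ∃ m, p = blockStart ψ u m)
    (hend : ∀ p, IsOccurrence v w' p → ∃ m, p + w'.length = blockStart ψ u m) :
    ∃ w, IsFactor u w ∧ w' = wordImage ψ w ∧ LiftsOccurrences ψ u v w := by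
  have hlift : ∀ p, IsOccurrence v w' p →
      ∃ m k, p = blockStart ψ u m ∧ w' = wordImage ψ (window u m k) := by
    intro p hp
    obtain ⟨m, hm⟩ := hstart p hp
    obtain ⟨k, hk⟩ := hend p hp
    have hmk : m ≤ k := (blockStart_strictMono hψ u).le_iff_le.1 (by omega)
    refine ⟨m, k - m, hm, ?_⟩
    rw [← H.window_eq hmk, ← hk, hm, Nat.add_sub_cancel_left, ← hm]
    exact hp.symm
  obtain ⟨p₀, hp₀⟩ := hw
  obtain ⟨m₀, k₀, -, hw₀⟩ := hlift p₀ hp₀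
  refine ⟨window u m₀ k₀, ⟨m₀, isOccurrence_window _ _ _⟩, hw₀, fun p hp => ?_⟩
  rw [← hw₀] at hp
  obtain ⟨m, k, hm, hw⟩ := hlift p hp
  rw [hinj (hw₀.symm.trans hw)]
  exact ⟨m, hm, isOccurrence_window _ _ _⟩

namespace LiftsOccurrences

variable {w : List A}

theorem exists_isFactor_cons (hψ : ∀ a, ψ a ≠ []) (H : IsImage ψ u v)
    (h : LiftsOccurrences ψ u v w) {b : B} (hb : IsFactor v (b :: wordImage ψ w)) :
    ∃ a, IsFactor u (a :: w) ∧ b = (ψ a).getLast (hψ a) := by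
  obtain ⟨j, hj⟩ := hb
  rw [isOccurrence_cons] at hj
  obtain ⟨_ | m, hjm, hm⟩ := h _ hj.2
  · simp at hjm
  · refine ⟨u m, ⟨m, isOccurrence_cons.2 ⟨rfl, hm⟩⟩, ?_⟩
    have hpos := List.length_pos_iff.2 (hψ (u m))
    rw [blockStart_succ] at hjm
    rw [← hj.1, show j = blockStart ψ u m + ((ψ (u m)).length - 1) by omega,
      H.apply_block (by omega), List.getLast_eq_getElem]

theorem exists_isFactor_append_singleton (hψ : ∀ a, ψ a ≠ []) (H : IsImage ψ u v)
    (h : LiftsOccurrences ψ u v w) {b : B} (hb : IsFactor v (wordImage ψ w ++ [b])) :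
    ∃ a, IsFactor u (w ++ [a]) ∧ b = (ψ a).head (hψ a) := by
  obtain ⟨j, hj⟩ := hb
  rw [isOccurrence_append, isOccurrence_singleton] at hj
  obtain ⟨m, rfl, hm⟩ := h _ hj.1
  refine ⟨u (m + w.length),
    ⟨m, isOccurrence_append.2 ⟨hm, isOccurrence_singleton.2 rfl⟩⟩, ?_⟩
  rw [← hj.2, ← blockStart_add_length ψ hm, List.head_eq_getElem]
  exact H.apply_block (List.length_pos_iff.2 (hψ _))

theorem isLeftSpecial (hψ : ∀ a, ψ a ≠ []) (H : IsImage ψ u v) (h : LiftsOccurrences ψ u v w)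
    (hw : IsFactor u w) (hs : IsLeftSpecial v (wordImage ψ w)) : IsLeftSpecial u w := by
  obtain ⟨-, b, b', hne, hb, hb'⟩ := hs
  obtain ⟨a, ha, hab⟩ := h.exists_isFactor_cons hψ H hb
  obtain ⟨a', ha', hab'⟩ := h.exists_isFactor_cons hψ H hb'
  refine ⟨hw, a, a', ?_, ha, ha'⟩
  rintro rfl
  exact hne (hab.trans hab'.symm)

theorem isRightSpecial (hψ : ∀ a, ψ a ≠ []) (H : IsImage ψ u v) (h : LiftsOccurrences ψ u v w)
    (hw : IsFactor u w) (hs : IsRightSpecial v (wordImage ψ w)) : IsRightSpecial u w := by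
  obtain ⟨-, b, b', hne, hb, hb'⟩ := hs
  obtain ⟨a, ha, hab⟩ := h.exists_isFactor_append_singleton hψ H hb
  obtain ⟨a', ha', hab'⟩ := h.exists_isFactor_append_singleton hψ H hb'
  refine ⟨hw, a, a', ?_, ha, ha'⟩
  rintro rfl
  exact hne (hab.trans hab'.symm)

theorem exists_isReturnWord (hψ : ∀ a, ψ a ≠ []) (H : IsImage ψ u v)
    (h : LiftsOccurrences ψ u v w) {r : List B} (hr : IsReturnWord v (wordImage ψ w) r) :
    ∃ s, IsReturnWord u w s ∧ r = wordImage ψ s := by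
  have hmono := blockStart_strictMono hψ u
  obtain ⟨j, l, hjl, hj, hl, hno, rfl⟩ := hr
  obtain ⟨m, rfl, hm⟩ := h j hj
  obtain ⟨m', rfl, hm'⟩ := h l hl
  have hlt := hmono.lt_iff_lt.1 hjl
  exact ⟨window u m (m' - m), ⟨m, m', hlt, hm, hm', fun k hmk hkm hk =>
    hno _ (hmono hmk) (hmono hkm) (H.occ_wordImage hk), rfl⟩, H.window_eq hlt.le⟩

end LiftsOccurrences

end synchronization

namespace IsMirrorCode

variable {π : A → List B}

theorem eq_of_mem (hπ : IsMirrorCode π) {a a' : A} {b : B} (h : b ∈ π a) (h' : b ∈ π a') :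
    a = a' :=
  by_contra fun hne => hπ.disjoint a a' hne b h h'

theorem wordImage_injective (hπ : IsMirrorCode π) : Function.Injective (wordImage π) := by
  refine RichWords.wordImage_injective hπ.ne_nil fun a a' h => ?_
  have hmem := List.head_mem (hπ.ne_nil a)
  exact hπ.eq_of_mem hmem (h.subset hmem)

theorem palindrome_iff (hπ : IsMirrorCode π) {p : List A} :
    p.Palindrome ↔ (wordImage π p).Palindrome := by
  rw [List.Palindrome.iff_reverse_eq, List.Palindrome.iff_reverse_eq, reverse_wordImage hπ.pal,
    hπ.wordImage_injective.eq_iff]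

variable {u : ℕ → A} {v : ℕ → B}

theorem eq_or_mirror_of_apply_eq (hπ : IsMirrorCode π) (h : IsImage π u v) {m m' o o' : ℕ}
    (ho : o < (π (u m)).length) (ho' : o' < (π (u m')).length)
    (heq : v (blockStart π u m + o) = v (blockStart π u m' + o')) :
    u m = u m' ∧ (o = o' ∨ o + o' + 1 = (π (u m)).length) := by
  rw [h.apply_block ho, h.apply_block ho'] at heq
  have hu : u m = u m' := hπ.eq_of_mem (heq ▸ List.getElem_mem ho) (List.getElem_mem ho')
  simp only [← hu] at heq
  exact ⟨hu, hπ.distinct _ _ _ _ _ heq⟩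

theorem apply_succ_ne_of_mirror (hπ : IsMirrorCode π) (h : IsImage π u v)
    (hsq : ∀ m, u m = u (m + 1) → 2 < (π (u m)).length) {m m' o o' : ℕ} (hu : u m = u m')
    (hlt : o < o') (hmirror : o + o' + 1 = (π (u m)).length) :
    v (blockStart π u m + (o + 1)) ≠ v (blockStart π u m' + (o' + 1)) := by
  intro heq
  have hlen : (π (u m)).length = (π (u m')).length := by rw [hu]
  by_cases hend : o' + 1 < (π (u m')).length
  · have := (hπ.eq_or_mirror_of_apply_eq h (by omega) hend heq).2
    omega
  · rw [show blockStart π u m' + (o' + 1) = blockStart π u (m' + 1) + 0 by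
      rw [blockStart_succ]; omega] at heq
    obtain ⟨hu', hoff⟩ := hπ.eq_or_mirror_of_apply_eq h (by omega)
      (List.length_pos_iff.2 (hπ.ne_nil _)) heq
    have := hsq m' (hu.symm.trans hu')
    omega

theorem aligned_of_apply_eq (hπ : IsMirrorCode π) (h : IsImage π u v)
    (hsq : ∀ m, u m = u (m + 1) → 2 < (π (u m)).length) {p p' : ℕ} (h₀ : v p = v p')
    (h₁ : v (p + 1) = v (p' + 1)) : Aligned π u p p' := by
  obtain ⟨m, o, rfl, ho⟩ := exists_block hπ.ne_nil u p
  obtain ⟨m', o', rfl, ho'⟩ := exists_block hπ.ne_nil u p'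
  obtain ⟨hu, hoff⟩ := hπ.eq_or_mirror_of_apply_eq h ho ho' h₀
  have hlen : (π (u m)).length = (π (u m')).length := by rw [hu]
  rcases lt_trichotomy o o' with hlt | rfl | hlt
  · exact absurd h₁ (hπ.apply_succ_ne_of_mirror h hsq hu hlt (by omega))
  · exact ⟨m, m', o, hu, ho, rfl, rfl⟩
  · exact absurd h₁.symm (hπ.apply_succ_ne_of_mirror h hsq hu.symm hlt (by omega))

theorem aligned_succ (hπ : IsMirrorCode π) (h : IsImage π u v) {p p' : ℕ}
    (hal : Aligned π u p p') (h₁ : v (p + 1) = v (p' + 1)) : Aligned π u (p + 1) (p' + 1) := by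
  obtain ⟨m, m', o, hu, ho, rfl, rfl⟩ := hal
  by_cases hlt : o + 1 < (π (u m)).length
  · exact ⟨m, m', o + 1, hu, hlt, rfl, rfl⟩
  · have hm : blockStart π u m + o + 1 = blockStart π u (m + 1) + 0 := by
      rw [blockStart_succ]; omega
    have hm' : blockStart π u m' + o + 1 = blockStart π u (m' + 1) + 0 := by
      rw [blockStart_succ, ← hu]; omega
    have hpos : ∀ k, 0 < (π (u k)).length := fun k => List.length_pos_iff.2 (hπ.ne_nil _)
    rw [hm, hm'] at h₁
    exact ⟨m + 1, m' + 1, 0, (hπ.eq_or_mirror_of_apply_eq h (hpos _) (hpos _) h₁).1, hpos _,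
      hm, hm'⟩

theorem isSynchronized (hπ : IsMirrorCode π) (h : IsImage π u v)
    (hsq : ∀ m, u m = u (m + 1) → 2 < (π (u m)).length) {w : List B} (hw : 1 < w.length) :
    IsSynchronized π u v w := by
  intro p p' hp hp'
  have heq : ∀ t < w.length, v (p + t) = v (p' + t) := fun t ht => by
    rw [isOccurrence_iff_getElem.1 hp t ht, isOccurrence_iff_getElem.1 hp' t ht]
  intro t
  induction t with
  | zero => exact fun ht => hπ.aligned_of_apply_eq h hsq (heq 0 ht) (heq 1 hw)
  | succ t ih => exact fun ht => hπ.aligned_succ h (ih (by omega)) (heq (t + 1) ht)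

theorem exists_isBispecial_preimage (hπ : IsMirrorCode π) (h : IsImage π u v)
    (hsq : ∀ m, u m = u (m + 1) → 2 < (π (u m)).length) {w' : List B}
    (hb : IsBispecial v w') (hw : 1 < w'.length) :
    ∃ w, IsBispecial u w ∧ w' = wordImage π w ∧
      ∀ r', IsReturnWord v w' r' → ∃ r, IsReturnWord u w r ∧ r' = wordImage π r := by
  have hsync := hπ.isSynchronized h hsq hw
  obtain ⟨w, hfac, rfl, hlift⟩ := exists_liftsOccurrences hπ.ne_nil hπ.wordImage_injective h hb.1.1
    (fun _ => hsync.exists_start_of_isLeftSpecial hπ.ne_nil h (by omega) hb.1)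
    (fun _ => hsync.exists_end_of_isRightSpecial hπ.ne_nil h (by omega) hb.2)
  exact ⟨w, ⟨hlift.isLeftSpecial hπ.ne_nil h hfac hb.1, hlift.isRightSpecial hπ.ne_nil h hfac hb.2⟩,
    rfl, fun _ hr => hlift.exists_isReturnWord hπ.ne_nil h hr⟩

end IsMirrorCode

theorem uSeq_val_add_one_of_eq_succ {n : ℕ} [NeZero n] (hn : 2 ≤ n) {m : ℕ}
    (h : uSeq n m = uSeq n (m + 1)) : (uSeq n m).val + 1 = n := by
  have H := isMarkedImage_uSeq (n := n) hn
  obtain ⟨k, o, rfl, ho⟩ := exists_block (marked_ne_nil 0 (phiTail n)) (uSeq n) m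
  have hne : next n (uSeq n k) ≠ 0 := fun h0 => H.not_mem (uSeq n k) (mem_phiTail.2 h0.symm)
  have hnext : ∀ t, t < (phiTail n (uSeq n k)).length →
      uSeq n (blockStart (marked 0 (phiTail n)) (uSeq n) k + (t + 1)) = next n (uSeq n k) :=
    fun t ht => (H.image.apply_block (by simpa [marked] using ht)).trans
      (mem_phiTail.1 (List.getElem_mem ht))
  rcases o with _ | o
  · rw [Nat.add_zero, H.apply_start, hnext 0 (List.length_pos_iff.2 (phiTail_ne_nil _))] at h
    exact absurd h.symm hne
  · have ho' : o < (phiTail n (uSeq n k)).length := by simpa [marked] using ho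
    rw [hnext o ho'] at h ⊢
    by_cases hl : o + 1 < (phiTail n (uSeq n k)).length
    · have hlast : ¬ (uSeq n k).val + 1 < n := fun hlt => by
        simp [phiTail, hlt] at hl
      rw [val_next]
      omega
    · rw [show blockStart (marked 0 (phiTail n)) (uSeq n) k + (o + 1) + 1 =
        blockStart (marked 0 (phiTail n)) (uSeq n) (k + 1) by rw [start_succ]; omega,
        H.apply_start] at h
      exact absurd h hne

/-! ### Weighted morphisms -/

theorem mirrorDistinct_of_maximal {p : List B} (hp : p.Palindrome) {c : B} (hc : c ∉ p)
    (hmax : ∀ q : List B, q.Palindrome → q.length = p.length →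
      {b | b ∈ q}.ncard ≤ {b | b ∈ p}.ncard) : MirrorDistinct p := by
  intro s t hs ht hst
  by_contra! hne
  set q := p.mapIdx fun k b => if k = t ∨ k + t + 1 = p.length then c else b with hq
  have hpal : q.Palindrome := palindrome_iff_getElem.2 fun k l hkl => by
    rw [List.length_mapIdx] at hkl
    simp only [hq, List.getElem_mapIdx, palindrome_iff_getElem.1 hp k l hkl,
      show (k = t ∨ k + t + 1 = p.length) ↔ (l = t ∨ l + t + 1 = p.length) by omega]
  have hsub : insert c {b | b ∈ p} ⊆ {b | b ∈ q} := by
    have hmem : ∀ k (hk : k < p.length), ¬ (k = t ∨ k + t + 1 = p.length) → p[k] ∈ q :=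
      fun k hk hkt => List.mem_mapIdx.2 ⟨k, hk, if_neg hkt⟩
    rintro b (rfl | hb)
    · exact List.mem_mapIdx.2 ⟨t, ht, if_pos (.inl rfl)⟩
    · obtain ⟨k, hk, rfl⟩ := List.getElem_of_mem hb
      by_cases hkt : k = t ∨ k + t + 1 = p.length
      · have hks : p[k] = p[s] := by
          rcases hkt with rfl | hkt
          · exact hst.symm
          · exact (palindrome_iff_getElem.1 hp k t hkt).trans hst.symm
        exact hks ▸ hmem s hs (by omega)
      · exact hmem k hk hkt
  have hle := (Set.ncard_le_ncard hsub (List.finite_toSet q)).trans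
    (hmax q hpal (List.length_mapIdx))
  have hcp : c ∉ {b | b ∈ p} := hc
  rw [Set.ncard_insert_of_notMem hcp (List.finite_toSet p)] at hle
  omega

section weighted

variable {d : ℕ} {π : Fin (2 * d + 1) → List B}

theorem IsWeightedMorphism.isMirrorCode (hπ : IsWeightedMorphism d π) (hd : 1 ≤ d) :
    IsMirrorCode π where
  ne_nil := hπ.ne_nil
  pal := hπ.palindrome
  distinct i := by
    have : Nontrivial (Fin (2 * d + 1)) := Fin.nontrivial_iff_two_le.2 (by omega)
    obtain ⟨j, hj⟩ := exists_ne i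
    obtain ⟨c, hc⟩ := List.exists_mem_of_ne_nil _ (hπ.ne_nil j)
    refine mirrorDistinct_of_maximal (hπ.palindrome i) (hπ.disjoint j i hj c hc) fun q hq hlen => ?_
    exact hπ.maximal i q hq (hlen.trans (hπ.length_eq i))
  disjoint := hπ.disjoint

theorem IsWeightedMorphism.length_zero (hπ : IsWeightedMorphism d π) (hd : 1 ≤ d) :
    (π 0).length = 1 := by
  rw [hπ.length_eq, weight, Fin.val_zero, if_pos (by omega)]

theorem IsWeightedMorphism.length_last (hπ : IsWeightedMorphism d π) (i : Fin (2 * d + 1))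
    (hi : i.val + 1 = 2 * d + 1) : (π i).length = 2 ^ d := by
  rw [hπ.length_eq, weight, if_neg (by omega)]
  congr 1
  omega

end weighted

end RichWords

theorem proposition8_general {B : Type*} {n : ℕ} [NeZero n] (hn : 2 ≤ n) {π : Fin n → List B}
    (hπ : IsMirrorCode π) (h0 : (π 0).length = 1) :
    (∀ p : List (Fin n), p.Palindrome ↔ (wordImage π p).Palindrome) ∧
    IsRichSeq (seqImage π hπ.ne_nil (uSeq n)) ∧
    ((∀ i : Fin n, i.val + 1 = n → 2 < (π i).length) →
      ∀ w', IsBispecial (seqImage π hπ.ne_nil (uSeq n)) w' → 1 < w'.length →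
        ∃ w, IsBispecial (uSeq n) w ∧ w' = wordImage π w ∧
          ∀ r', IsReturnWord (seqImage π hπ.ne_nil (uSeq n)) w' r' →
            ∃ r, IsReturnWord (uSeq n) w r ∧ r' = wordImage π r) := by
  have himg := isImage_seqImage π hπ.ne_nil (uSeq n)
  obtain ⟨a, ha⟩ := List.length_eq_one_iff.1 h0
  exact ⟨fun _ => hπ.palindrome_iff, isRichSeq_image_uSeq hn hπ ha himg,
    fun hlast _ => hπ.exists_isBispecial_preimage himg fun _ hm =>
      hlast _ (uSeq_val_add_one_of_eq_succ hn hm)⟩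

theorem proposition8 {B : Type*} (d : ℕ) (hd : 1 ≤ d) (π : Fin (2 * d + 1) → List B)
    (hπ : IsWeightedMorphism d π) :
    (∀ p, IsFactor (uSeq (2 * d + 1)) p → (p.Palindrome ↔ (wordImage π p).Palindrome)) ∧
    IsRichSeq (seqImage π hπ.ne_nil (uSeq (2 * d + 1))) ∧
    (2 ≤ d → ∀ w', IsBispecial (seqImage π hπ.ne_nil (uSeq (2 * d + 1))) w' → 1 < w'.length →
      ∃ w, IsBispecial (uSeq (2 * d + 1)) w ∧ w' = wordImage π w ∧
        ∀ r', IsReturnWord (seqImage π hπ.ne_nil (uSeq (2 * d + 1))) w' r' →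
          ∃ r, IsReturnWord (uSeq (2 * d + 1)) w r ∧ r' = wordImage π r) := by
  obtain ⟨hpal, hrich, hbi⟩ :=
    proposition8_general (by omega) (hπ.isMirrorCode hd) (hπ.length_zero hd)
  exact ⟨fun p _ => hpal p, hrich, fun hd2 => hbi fun i hi =>
    (hπ.length_last i hi).symm ▸ lt_self_pow₀ one_lt_two hd2⟩
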